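/- Call a topological space $X$ an FLS space if it is Hausdorff, first-countable, Lindelöf and scattered (every nonempty subspace has an isolated point). Put $X^{(0)}=X$ and, for every ordinal $\alpha>0$, let $X^{(\alpha)}=\bigcap_{\xi<\alpha}(X^{(\xi)})^{(1)}$, where $Y^{(1)}$ is the set of non-isolated points of a space $Y$; the scattered height of a scattered space $X$ is the least ordinal $\alpha$ with $X^{(\alpha)}=\emptyset$. For an ordinal $\lambda$ let $\lim\lambda$ be the unique ordinal that is zero or a limit ordinal and satisfies $\lambda=\lim\lambda+n$ for some $n\in\omega$. Let $\mathfrak b$ and $\mathfrak d$ be the least cardinality of a $\le^*$-unbounded, respectively of a $\le^*$-dominating, subset of $\omega^\omega$, let $\mathrm{cov}(\mathcal M)$ be the least cardinality of a cover of $\omega^\omega$ by nowhere dense sets, and let $\mathfrak c=2^{\aleph_0}$. If $\omega_1<\mathfrak b=\mathfrak d=\mathrm{cov}(\mathcal M)$, then for every ordinal $\lambda$ the following conditions are equivalent: (1) $\lambda$ is the scattered height of some uncountable FLS space; (2) $\omega\le\lambda<\mathfrak c^+$, $\mathrm{cf}(\lambda)\le\omega$ and $\mathrm{cf}(\lim\lambda)\in\{\omega,\mathrm{cf}(\mathfrak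 d)\}$. In particular, (1) and (2) are equivalent for every ordinal $\lambda$ if Martin's Axiom holds and $\omega_1<\mathfrak c$. -/

import Mathlib

open Cardinal

universe u

/-- A space is scattered if every nonempty subspace `A` has an isolated point. -/
def IsScatteredSpace (X : Type u) [TopologicalSpace X] : Prop :=
  ∀ A : Set X, A.Nonempty → ∃ x ∈ A, ∃ U : Set X, IsOpen U ∧ U ∩ A = {x}

/-- FLS spaces: first-countable Lindelöf scattered Hausdorff spaces. -/
structure IsFLS (X : Type u) [TopologicalSpace X] : Prop where
  t2 : T2Space X
  firstCountable : FirstCountableTopology X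
  lindelof : LindelofSpace X
  scattered : IsScatteredSpace X

/-- The `α`-th Cantor–Bendixson derivative `X^(α)` of the whole space `X`: here `X^(0) = X`, and
`X^(α)` is the intersection over `ξ < α` of the sets of non-isolated points of the
subspaces `X^(ξ)`. -/
def cbDerivative (X : Type u) [TopologicalSpace X] (α : Ordinal.{u}) : Set X :=
  CantorBendixson.iteratedDerivedSet (Set.univ : Set X) α

/-- The scattered height of a scattered space: the least ordinal `α` with `X^(α) = ∅`. -/
noncomputable def scatteredHeight (X : Type u) [TopologicalSpace X] : Ordinal.{u} :=
  sInf {α : Ordinal.{u} | cbDerivative X α = ∅}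

/-- A nonempty subset of a scattered space is not fixed by the derivative. -/
theorem exists_not_mem_relDerivedSet {X : Type u} [TopologicalSpace X]
    (hX : IsScatteredSpace X) {A : Set X} (hA : A.Nonempty) : ∃ x ∈ A, x ∉ relDerivedSet A := by
  obtain ⟨x, hx, U, hU, hUA⟩ := hX A hA
  refine ⟨x, hx, fun hx' => ?_⟩
  have hacc : AccPt x (Filter.principal A) := hx'.1
  have hxU : x ∈ U := by
    have h : x ∈ U ∩ A := by rw [hUA]; rfl
    exact h.1
  obtain ⟨y, hy, hyx⟩ := accPt_iff_nhds.1 hacc U (hU.mem_nhds hxU)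
  rw [hUA] at hy
  exact hyx hy

/-- In a scattered space some derivative is empty, so the infimum above is attained. -/
theorem cbDerivative_scatteredHeight {X : Type u} [TopologicalSpace X]
    (hX : IsScatteredSpace X) : cbDerivative X (scatteredHeight X) = ∅ := by
  have hne : {α : Ordinal.{u} | cbDerivative X α = ∅}.Nonempty := by
    obtain ⟨a, ha⟩ := CantorBendixson.iteratedDerivedSet_mem_fixedPoints (Set.univ : Set X)
    refine ⟨a, ?_⟩
    by_contra h
    obtain ⟨x, hx, hx'⟩ := exists_not_mem_relDerivedSet hX (Set.nonempty_iff_ne_empty.2 h)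
    have hfix : relDerivedSet (cbDerivative X a) = cbDerivative X a := ha
    exact hx' (hfix.symm ▸ hx)
  exact csInf_mem hne

/-- For a scattered space, the scattered height, as a set of smaller ordinals, is the range of the
function assigning to a point `x` the ordinal `α` with `x ∈ X^(α)` and `x ∉ X^(α+1)`. -/
theorem lt_scatteredHeight_iff {X : Type u} [TopologicalSpace X] (hX : IsScatteredSpace X)
    (α : Ordinal.{u}) :
    α < scatteredHeight X ↔ ∃ x, x ∈ cbDerivative X α ∧ x ∉ cbDerivative X (α + 1) := by
  constructor
  · intro hα
    have hne : cbDerivative X α ≠ ∅ := fun h => (notMem_of_lt_csInf' hα) h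
    obtain ⟨x, hx, hx'⟩ := exists_not_mem_relDerivedSet hX (Set.nonempty_iff_ne_empty.2 hne)
    refine ⟨x, hx, ?_⟩
    rw [cbDerivative, CantorBendixson.iteratedDerivedSet_succ]
    exact hx'
  · rintro ⟨x, hx, -⟩
    by_contra h
    have hx2 := CantorBendixson.iteratedDerivedSet_antitone (Set.univ : Set X) (not_lt.1 h) hx
    change x ∈ cbDerivative X (scatteredHeight X) at hx2
    rw [cbDerivative_scatteredHeight hX] at hx2
    exact hx2

/-- The limit part of an ordinal: the limit ordinal (zero is allowed) `l` with `o = l + n` for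
a natural number `n`. -/
noncomputable def limitPart (o : Ordinal.{u}) : Ordinal.{u} :=
  Ordinal.omega0 * (o / Ordinal.omega0)

/-- The limit part is a non-successor ordinal that differs from `o` by a natural number. -/
theorem limitPart_spec (o : Ordinal.{u}) :
    Order.IsSuccPrelimit (limitPart o) ∧ ∃ n : ℕ, o = limitPart o + n := by
  refine ⟨Ordinal.isSuccPrelimit_iff_omega0_dvd.2 (Dvd.intro _ rfl), ?_⟩
  obtain ⟨n, hn⟩ := Ordinal.lt_omega0.1 (Ordinal.mod_lt o Ordinal.omega0_ne_zero)
  exact ⟨n, by rw [← hn, limitPart, Ordinal.div_add_mod]⟩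

/-- `f ≤* g`: `f n ≤ g n` for all but finitely many `n`. -/
def EventuallyDominated (f g : ℕ → ℕ) : Prop :=
  ∀ᶠ n in Filter.atTop, f n ≤ g n

/-- The unbounding number: the least cardinality of a `≤*`-unbounded subset of `ω^ω`. -/
noncomputable def unboundingNumber : Cardinal.{0} :=
  sInf {κ | ∃ B : Set (ℕ → ℕ), (¬ ∃ g, ∀ f ∈ B, EventuallyDominated f g) ∧ #B = κ}

/-- The dominating number: the least cardinality of a `≤*`-dominating subset of `ω^ω`. -/
noncomputable def dominatingNumber : Cardinal.{0} :=
  sInf {κ | ∃ D : Set (ℕ → ℕ), (∀ f, ∃ g ∈ D, EventuallyDominated f g) ∧ #D = κ}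

/-- `cov(ℳ)`: the least cardinality of a cover of `ω^ω` (with the product topology) by nowhere
dense subsets. -/
noncomputable def covMeager : Cardinal.{0} :=
  sInf {κ | ∃ S : Set (Set (ℕ → ℕ)),
    (∀ s ∈ S, IsNowhereDense s) ∧ ⋃₀ S = Set.univ ∧ #S = κ}

/-- The countable chain condition: every set of pairwise incompatible conditions is countable. -/
def IsCCC (P : Type u) [PartialOrder P] : Prop :=
  ∀ A : Set P, A.Pairwise (fun p q => ¬ ∃ r, r ≤ p ∧ r ≤ q) → A.Countable

/-- Martin's Axiom: for every nonempty ccc poset and every family of fewer than `𝔠` dense subsets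
there is a filter that meets all members of the family. -/
def MartinsAxiom : Prop :=
  ∀ (P : Type) [PartialOrder P] [Nonempty P], IsCCC P →
    ∀ 𝒟 : Set (Set P), #𝒟 < 𝔠 → (∀ D ∈ 𝒟, ∀ p, ∃ q ∈ D, q ≤ p) →
      ∃ G : Order.PFilter P, ∀ D ∈ 𝒟, ∃ p ∈ D, p ∈ G

/-!
Write `κ = 𝔟 = 𝔡 = cov(ℳ)`; `κ` is regular because `𝔟 = 𝔡` (`cof_ord_dominatingNumber`).

**Necessity.** Let `X` be an uncountable FLS space of height `l = μ + n`, with `μ` the limit part.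
An instance of Arhangel'skii's theorem (`mk_le_continuum_of_lindelof`) gives `l < 𝔠⁺`, and the
Lindelöf property gives `cf(l) ≤ ω`. A countable subset of `X` has a neighbourhood for each function
in `ω^ω`, so from `ω₁ < 𝔟` it follows that `X^(α)` is countable whenever `X^(α+1)` is
(`countable_cbDerivative_of_succ`). Hence `X^(μ)` is countable, and `μ ≠ 0`. If `cf(μ) > ω`, then
for each `g` the complement of the neighbourhood of `X^(μ)` coded by `g` is Lindelöf, so that it
misses some `X^(α g)` with `α g < μ`. The map `α` is monotone and cofinal in `μ`, which squeezes
`cf(μ)` between `𝔟` and `𝔡` (`cof_eq_dominatingNumber`).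

**Sufficiency.** For a rank function `ρ` from the Cantor space to `l`, let a point `x` have the
neighbourhoods `{x} ∪ {y ∈ V | ρ y < ρ x}`, with `V` an ordinary neighbourhood of `x`. This topology
(`RankSpace`) is Hausdorff, first-countable and scattered, and of height `l` if all levels of `ρ`
are dense. It remains to make it Lindelöf. Ranks `μ + i` are given to countable sets. If
`cf(μ) = ω`, the ranks below `μ` come from a Bernstein colouring (`exists_bernstein_coloring`): an
open set that contains a level has countable complement, and so it is enough to cover countably many
levels. If `cf(μ) = κ`, then the set `C` of points of rank at least `μ` is nonempty, countable and
dense, and a dominating family exhausts the complement of `C` by `κ` many `σ`-closed sets; the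
colouring is cut off on the `i`-th of them at an ordinal `θ i < μ` of countable cofinality, with
`θ` cofinal in `μ`. Closed sets inside the `i`-th set are Lindelöf by induction on `i`, and density
of the levels is preserved, since `cov(ℳ) = κ` provides perfect sets that avoid fewer than `κ`
nowhere dense sets (`exists_perfect_disjoint`). Both cases are instances of `exists_rank_function`.

**Martin's Axiom.** Hechler forcing gives `𝔠 ≤ 𝔟`, and Cohen forcing gives `𝔠 ≤ cov(ℳ)`.
-/

/-! ### Cardinal characteristics -/

theorem EventuallyDominated.trans {f g h : ℕ → ℕ} (hfg : EventuallyDominated f g)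
    (hgh : EventuallyDominated g h) : EventuallyDominated f h := by
  filter_upwards [hfg, hgh] with n h1 h2 using h1.trans h2

theorem EventuallyDominated.exists_le_max {f g : ℕ → ℕ} (h : EventuallyDominated f g) :
    ∃ m, ∀ n, f n ≤ max (g n) m := by
  obtain ⟨N, hN⟩ := Filter.eventually_atTop.1 h
  refine ⟨∑ i ∈ Finset.range N, f i, fun n => ?_⟩
  rcases lt_or_ge n N with hn | hn
  · exact le_max_of_le_right
      (Finset.single_le_sum (f := f) (fun _ _ => Nat.zero_le _) (Finset.mem_range.2 hn))
  · exact le_max_of_le_left (hN n hn)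

theorem exists_eventuallyDominated_of_card_lt {B : Set (ℕ → ℕ)} (hB : #B < unboundingNumber) :
    ∃ g, ∀ f ∈ B, EventuallyDominated f g := by
  by_contra h
  exact notMem_of_lt_csInf' hB ⟨B, h, rfl⟩

theorem dominating_univ (f : ℕ → ℕ) :
    ∃ g ∈ (Set.univ : Set (ℕ → ℕ)), EventuallyDominated f g :=
  ⟨f, trivial, Filter.Eventually.of_forall fun _ => le_rfl⟩

theorem exists_dominating_family :
    ∃ D : Set (ℕ → ℕ), (∀ f, ∃ g ∈ D, EventuallyDominated f g) ∧ #D = dominatingNumber :=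
  csInf_mem (s := {κ | ∃ D : Set (ℕ → ℕ), (∀ f, ∃ g ∈ D, EventuallyDominated f g) ∧ #D = κ})
    ⟨_, Set.univ, dominating_univ, rfl⟩

theorem dominatingNumber_le_continuum : dominatingNumber ≤ 𝔠 := by
  have h : dominatingNumber ≤ #(Set.univ : Set (ℕ → ℕ)) :=
    csInf_le' ⟨Set.univ, dominating_univ, rfl⟩
  simpa using h

theorem not_dominating_of_bounded {D : Set (ℕ → ℕ)}
    (hD : ∀ f, ∃ g ∈ D, EventuallyDominated f g) :
    ¬ ∃ g, ∀ f ∈ D, EventuallyDominated f g := by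
  rintro ⟨g, hg⟩
  obtain ⟨f, hf, hgf⟩ := hD (fun n => g n + 1)
  obtain ⟨n, hn⟩ := (hgf.trans (hg f hf)).exists
  exact Nat.not_succ_le_self _ hn

theorem unboundingNumber_le_dominatingNumber : unboundingNumber ≤ dominatingNumber := by
  obtain ⟨D, hD, hDc⟩ := exists_dominating_family
  exact csInf_le' ⟨D, not_dominating_of_bounded hD, hDc⟩

/-- If `𝔟 = 𝔡`, then `𝔡` is regular: a dominating family that splits into fewer than `𝔟` pieces
of size less than `𝔟` would be bounded. -/
theorem cof_ord_dominatingNumber (h : unboundingNumber = dominatingNumber) :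
    dominatingNumber.ord.cof = dominatingNumber := by
  refine le_antisymm (Ordinal.cof_ord_le _) (le_of_not_gt fun hlt => ?_)
  obtain ⟨D, hD, hDc⟩ := exists_dominating_family
  obtain ⟨e⟩ : Nonempty (dominatingNumber.ord.ToType ≃ D) := by
    rw [← Cardinal.eq, hDc, mk_ord_toType]
  rw [← Ordinal.cof_toType] at hlt
  obtain ⟨T, hT, hTc⟩ := Order.exists_cof_eq dominatingNumber.ord.ToType
  have hb : ∀ t : dominatingNumber.ord.ToType,
      ∃ g, ∀ j < t, EventuallyDominated (e j : ℕ → ℕ) g := by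
    intro t
    obtain ⟨g, hg⟩ := exists_eventuallyDominated_of_card_lt
      (B := (fun j => (e j : ℕ → ℕ)) '' Set.Iio t)
      (mk_image_le.trans_lt (by simpa [h] using mk_Iio_lt t (by simp)))
    exact ⟨g, fun j hj => hg _ ⟨j, hj, rfl⟩⟩
  choose g hg using hb
  obtain ⟨G, hG⟩ := exists_eventuallyDominated_of_card_lt
    (B := (fun t => fun n => max (g t n) ((e t : ℕ → ℕ) n)) '' T)
    (mk_image_le.trans_lt (by rw [hTc, h]; exact hlt))
  refine not_dominating_of_bounded hD ⟨G, fun f hf => ?_⟩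
  obtain ⟨t, ht, htj⟩ := hT (e.symm ⟨f, hf⟩)
  have h1 := hG _ ⟨t, ht, rfl⟩
  rcases htj.lt_or_eq with hlt | heq
  · have h2 := hg t _ hlt
    simp only [Equiv.apply_symm_apply] at h2
    filter_upwards [h1, h2] with n h3 h4 using h4.trans ((le_max_left _ _).trans h3)
  · filter_upwards [h1] with n h3
    rw [← heq] at h3
    simp only [Equiv.apply_symm_apply] at h3
    exact (le_max_right _ _).trans h3

theorem exists_forall_notMem_of_card_lt_covMeager {ι : Type} (hι : #ι < covMeager)
    (N : ι → Set (ℕ → ℕ)) (hN : ∀ i, IsNowhereDense (N i)) : ∃ z, ∀ i, z ∉ N i := by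
  by_contra! h
  refine notMem_of_lt_csInf' (mk_range_le.trans_lt hι) ⟨Set.range N, ?_, ?_, rfl⟩
  · rintro _ ⟨i, rfl⟩
    exact hN i
  · refine Set.eq_univ_of_forall fun z => ?_
    obtain ⟨i, hi⟩ := h z
    exact ⟨_, ⟨i, rfl⟩, hi⟩

/-! ### Generic sequences -/

theorem exists_cylinder_subset {α : Type*} [TopologicalSpace α] [DiscreteTopology α]
    {W : Set (ℕ → α)} (hW : IsOpen W) {x : ℕ → α} (hx : x ∈ W) :
    ∃ m, PiNat.cylinder x m ⊆ W := by
  obtain ⟨s, ⟨y, n, rfl⟩, hxs, hs⟩ :=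
    (PiNat.isTopologicalBasis_cylinders (fun _ : ℕ => α)).exists_subset_of_mem_open hx hW
  exact ⟨n, by rwa [PiNat.mem_cylinder_iff_eq.1 hxs]⟩

/-- A form of `cov(ℳ)` for countable forcing notions: fewer than `cov(ℳ)` dense sets are met by
one decreasing sequence. A point of `ω^ω` codes a sequence of attempts to extend the current
condition, and the points whose sequence misses a given dense set are nowhere dense. -/
theorem exists_generic_sequence {Q : Type} [Countable Q] (r : Q → Q → Prop)
    (hrefl : ∀ p, r p p) (htrans : ∀ p q s, r p q → r q s → r p s) (q₀ : Q)
    {ι : Type} (hι : #ι < covMeager) (D : ι → Set Q) (hD : ∀ i q, ∃ p ∈ D i, r p q) :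
    ∃ q : ℕ → Q, q 0 = q₀ ∧ (∀ k l, k ≤ l → r (q l) (q k)) ∧ ∀ i, ∃ k, q k ∈ D i := by
  classical
  have : Nonempty Q := ⟨q₀⟩
  obtain ⟨e, he⟩ := exists_surjective_nat Q
  let G : (ℕ → ℕ) → ℕ → Q := fun z k =>
    Nat.rec q₀ (fun k q => if r (e (z k)) q then e (z k) else q) k
  have hG0 : ∀ z, G z 0 = q₀ := fun z => rfl
  have hGs : ∀ z k, G z (k + 1) = if r (e (z k)) (G z k) then e (z k) else G z k :=
    fun z k => rfl
  have hGr : ∀ z k, r (G z (k + 1)) (G z k) := by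
    intro z k
    rw [hGs]
    split_ifs with h
    · exact h
    · exact hrefl _
  have hGc : ∀ k z w, z ∈ PiNat.cylinder w k → G z k = G w k := by
    intro k
    induction k with
    | zero => intro z w _; rfl
    | succ k ih =>
      intro z w hz
      rw [hGs, hGs, ih z w (PiNat.cylinder_anti w k.le_succ hz), hz k k.lt_succ_self]
  obtain ⟨z, hz⟩ := exists_forall_notMem_of_card_lt_covMeager hι
    (fun i => {z | ∀ k, G z k ∉ D i}) (by
      intro i
      refine Set.eq_empty_of_forall_notMem fun w hw => ?_
      obtain ⟨m, hm⟩ := exists_cylinder_subset isOpen_interior hw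
      obtain ⟨p, hp, hpr⟩ := hD i (G w m)
      obtain ⟨c, rfl⟩ := he p
      have hz := PiNat.update_mem_cylinder w m c
      set z := Function.update w m c
      have hzm : G z (m + 1) ∈ D i := by
        rw [hGs, hGc m z w hz]
        simp only [z, Function.update_self]
        rwa [if_pos hpr]
      obtain ⟨y, hy, hyN⟩ := mem_closure_iff.1 (interior_subset (hm hz))
        (PiNat.cylinder z (m + 1)) (PiNat.isOpen_cylinder (fun _ : ℕ => ℕ) z (m + 1))
        (PiNat.self_mem_cylinder z (m + 1))
      exact hyN (m + 1) (by rw [hGc _ _ _ hy]; exact hzm))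
  refine ⟨G z, hG0 z, fun k l hkl => ?_, fun i => ?_⟩
  · induction l, hkl using Nat.le_induction with
    | base => exact hrefl _
    | succ l _ ih => exact htrans _ _ _ (hGr z l) ih
  · by_contra! h
    exact hz i h

/-! ### Perfect sets of generic points -/

/-- If `F` is a nonempty perfect subset of the Cantor space, then the union of fewer than `cov(ℳ)`
closed sets that are nowhere dense in `F` misses a nonempty perfect subset of `F`. A condition
`(U, n)` promises that the perfect set is contained in the clopen set `U` and meets each cylinder of
length `n` that meets `U ∩ F`. -/
theorem exists_perfect_disjoint {F : Set (ℕ → Bool)} (hF : Perfect F) (hFne : F.Nonempty)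
    {ι : Type} (hι : #ι < covMeager) (hc : ℵ₀ < covMeager) (N : ι → Set (ℕ → Bool))
    (hNc : ∀ i, IsClosed (N i))
    (hN : ∀ i, ∀ W : Set (ℕ → Bool), IsOpen W → (W ∩ F).Nonempty → ∃ x ∈ W ∩ F, x ∉ N i) :
    ∃ E ⊆ F, Perfect E ∧ E.Nonempty ∧ ∀ i, Disjoint E (N i) := by
  classical
  have : Countable (TopologicalSpace.Clopens (ℕ → Bool)) :=
    TopologicalSpace.Clopens.countable_iff_secondCountable.2 inferInstance
  have hcl : ∀ (x : ℕ → Bool) m, IsClopen (PiNat.cylinder x m) := by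
    intro x m
    refine ⟨?_, PiNat.isOpen_cylinder (fun _ : ℕ => Bool) x m⟩
    rw [PiNat.cylinder_eq_pi]
    exact isClosed_set_pi fun i _ => isClosed_discrete _
  have hceq : ∀ {x y : ℕ → Bool} {n}, y ∈ PiNat.cylinder x n →
      PiNat.cylinder y n = PiNat.cylinder x n := fun h => PiNat.mem_cylinder_iff_eq.1 h
  let r : TopologicalSpace.Clopens (ℕ → Bool) × ℕ → TopologicalSpace.Clopens (ℕ → Bool) × ℕ →
      Prop := fun p q => (p.1 : Set (ℕ → Bool)) ⊆ q.1 ∧ q.2 ≤ p.2 ∧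
        ∀ x ∈ (q.1 : Set (ℕ → Bool)) ∩ F, ∃ y ∈ (p.1 : Set (ℕ → Bool)) ∩ F,
          y ∈ PiNat.cylinder x q.2
  -- Meeting `D (inl i)` keeps the perfect set off `N i`; meeting `D (inr m)` for all `m` makes each
  -- of its points a limit of others, since two points in one cylinder of length `m` are then kept apart.
  let D : ι ⊕ ℕ → Set (TopologicalSpace.Clopens (ℕ → Bool) × ℕ) := Sum.elim
    (fun i => {p | Disjoint ((p.1 : Set (ℕ → Bool)) ∩ F) (N i)})
    (fun m => {p | m ≤ p.2 ∧ ∀ x ∈ (p.1 : Set (ℕ → Bool)) ∩ F,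
      ∃ y ∈ (p.1 : Set (ℕ → Bool)) ∩ F, y ∈ PiNat.cylinder x m ∧ y ∉ PiNat.cylinder x p.2})
  have hcard : #(ι ⊕ ℕ) < covMeager := by
    rw [mk_sum]
    simpa using add_lt_of_lt hc.le hι hc
  have hUF : ∀ U : TopologicalSpace.Clopens (ℕ → Bool),
      IsCompact ((U : Set (ℕ → Bool)) ∩ F) :=
    fun U => (U.isClopen.1.inter hF.closed).isCompact
  have hDdense : ∀ i q, ∃ p ∈ D i, r p q := by
    rintro (i | m) ⟨U, n⟩
    · have h1 : ∀ x ∈ (U : Set (ℕ → Bool)) ∩ F, ∃ y ∈ F, ∃ m, y ∈ PiNat.cylinder x n ∧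
          PiNat.cylinder y m ⊆ (U : Set (ℕ → Bool)) ∧ Disjoint (PiNat.cylinder y m) (N i) := by
        intro x hx
        obtain ⟨y, ⟨⟨hyU, hyx⟩, hyF⟩, hyN⟩ := hN i (U ∩ PiNat.cylinder x n)
          (U.isClopen.2.inter (hcl x n).2) ⟨x, ⟨hx.1, PiNat.self_mem_cylinder x n⟩, hx.2⟩
        obtain ⟨m, hm⟩ := exists_cylinder_subset (U.isClopen.2.inter (hNc i).isOpen_compl)
          ⟨hyU, hyN⟩
        exact ⟨y, hyF, m, hyx, fun z hz => (hm hz).1,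
          Set.disjoint_left.2 fun z hz => (hm hz).2⟩
      choose! y hyF m hyx hyU hyN using h1
      obtain ⟨T, hTU, hT⟩ := (hUF U).elim_nhds_subcover (fun x => PiNat.cylinder x n)
        (fun x _ => (hcl x n).2.mem_nhds (PiNat.self_mem_cylinder x n))
      refine ⟨(⟨⋃ x ∈ T, PiNat.cylinder (y x) (m x),
        T.finite_toSet.isClopen_biUnion fun x _ => hcl _ _⟩, n), ?_, ?_, le_rfl, ?_⟩
      · refine Set.disjoint_left.2 ?_
        rintro z ⟨hz, -⟩
        obtain ⟨x, hxT, hzx⟩ := Set.mem_iUnion₂.1 hz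
        exact Set.disjoint_left.1 (hyN x (hTU x hxT)) hzx
      · exact Set.iUnion₂_subset fun x hxT => hyU x (hTU x hxT)
      · intro z hz
        obtain ⟨x, hxT, hzx⟩ := Set.mem_iUnion₂.1 (hT hz)
        refine ⟨y x, ⟨Set.mem_iUnion₂.2 ⟨x, hxT, PiNat.self_mem_cylinder _ _⟩,
          hyF x (hTU x hxT)⟩, ?_⟩
        change y x ∈ PiNat.cylinder z n
        rw [hceq hzx]
        exact hyx x (hTU x hxT)
    · have h1 : ∀ x ∈ (U : Set (ℕ → Bool)) ∩ F, ∃ y ∈ (U : Set (ℕ → Bool)) ∩ F,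
          ∃ k, m ≤ k ∧ y ∈ PiNat.cylinder x m ∧ y ∉ PiNat.cylinder x k := by
        intro x hx
        obtain ⟨y, ⟨⟨hyU, hyx⟩, hyF⟩, hne⟩ := preperfect_iff_nhds.1 hF.acc x hx.2
          (U ∩ PiNat.cylinder x m)
          ((U.isClopen.2.inter (hcl x m).2).mem_nhds ⟨hx.1, PiNat.self_mem_cylinder x m⟩)
        obtain ⟨k, hk⟩ := exists_cylinder_subset (isOpen_compl_singleton (x := y)) (x := x)
          (by simpa using hne.symm)
        exact ⟨y, ⟨hyU, hyF⟩, max m k, le_max_left _ _, hyx,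
          fun h => hk (PiNat.cylinder_anti x (le_max_right _ _) h) rfl⟩
      choose! y hyF k hmk hym hyk using h1
      obtain ⟨T, hTU, hT⟩ := (hUF U).elim_nhds_subcover (fun x => PiNat.cylinder x (k x))
        (fun x _ => (hcl x _).2.mem_nhds (PiNat.self_mem_cylinder x _))
      refine ⟨(U, max n (max m (T.sup k))), ⟨?_, ?_⟩, subset_rfl, le_max_left _ _, ?_⟩
      · exact (le_max_left m _).trans (le_max_right _ _)
      · intro z hz
        obtain ⟨x, hxT, hzx⟩ := Set.mem_iUnion₂.1 (hT hz)
        refine ⟨y x, hyF x (hTU x hxT), ?_, fun h => hyk x (hTU x hxT) ?_⟩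
        · rw [hceq (PiNat.cylinder_anti x (hmk x (hTU x hxT)) hzx)]
          exact hym x (hTU x hxT)
        · rw [← hceq hzx]
          exact PiNat.cylinder_anti z (((Finset.le_sup hxT).trans (le_max_right m _)).trans
            (le_max_right n _)) h
      · intro x hx
        exact ⟨x, hx, PiNat.self_mem_cylinder _ _⟩
  obtain ⟨q, hq0, hqr, hqD⟩ := exists_generic_sequence r
    (fun p => ⟨subset_rfl, le_rfl, fun x hx => ⟨x, hx, PiNat.self_mem_cylinder _ _⟩⟩)
    (by
      rintro p q s ⟨h1, h2, h3⟩ ⟨h4, h5, h6⟩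
      refine ⟨h1.trans h4, h5.trans h2, fun x hx => ?_⟩
      obtain ⟨y, hy, hyx⟩ := h6 x hx
      obtain ⟨z, hz, hzy⟩ := h3 y hy
      refine ⟨z, hz, ?_⟩
      rw [← hceq hyx]
      exact PiNat.cylinder_anti y h5 hzy)
    (⊤, 0) hcard D hDdense
  -- By compactness each cylinder reserved by some condition contains a point of the intersection.
  have key : ∀ k, ∀ x ∈ ((q k).1 : Set (ℕ → Bool)) ∩ F,
      ∃ y, (∀ l, y ∈ ((q l).1 : Set (ℕ → Bool)) ∩ F) ∧ y ∈ PiNat.cylinder x (q k).2 := by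
    intro k x hx
    have hne := IsCompact.nonempty_iInter_of_sequence_nonempty_isCompact_isClosed
      (fun j => ((q (k + j)).1 : Set (ℕ → Bool)) ∩ F ∩ PiNat.cylinder x (q k).2)
      (fun j => by
        refine Set.inter_subset_inter_left _ (Set.inter_subset_inter_left _ ?_)
        exact (hqr (k + j) (k + (j + 1)) (by omega)).1)
      (fun j => by
        obtain ⟨y, hy, hyx⟩ := (hqr k (k + j) (by omega)).2.2 x hx
        exact ⟨y, hy, hyx⟩)
      ((hUF _).inter_right (hcl _ _).1)
      (fun j => (((q (k + j)).1.isClopen.1.inter hF.closed)).inter (hcl _ _).1)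
    obtain ⟨y, hy⟩ := hne
    rw [Set.mem_iInter] at hy
    refine ⟨y, fun l => ⟨(hqr l (k + l) (by omega)).1 (hy l).1.1, (hy 0).1.2⟩, (hy 0).2⟩
  refine ⟨⋂ l, ((q l).1 : Set (ℕ → Bool)) ∩ F, (Set.iInter_subset _ 0).trans
    Set.inter_subset_right, ⟨isClosed_iInter fun l => (q l).1.isClopen.1.inter hF.closed, ?_⟩,
    ?_, ?_⟩
  · refine preperfect_iff_nhds.2 fun x hx U hU => ?_
    rw [Set.mem_iInter] at hx
    obtain ⟨V, hVU, hV, hxV⟩ := mem_nhds_iff.1 hU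
    obtain ⟨m, hm⟩ := exists_cylinder_subset hV hxV
    obtain ⟨k, hmk, hk⟩ := hqD (Sum.inr m)
    obtain ⟨y, hy, hyx, hyn⟩ := hk x (hx k)
    obtain ⟨w, hw, hwy⟩ := key k y hy
    refine ⟨w, ⟨hVU (hm ?_), Set.mem_iInter.2 hw⟩, ?_⟩
    · rw [← hceq hyx]
      exact PiNat.cylinder_anti y hmk hwy
    · rintro rfl
      exact hyn ((PiNat.mem_cylinder_comm _ _ _).1 hwy)
  · obtain ⟨x, hx⟩ := hFne
    obtain ⟨y, hy, -⟩ := key 0 x ⟨by rw [hq0]; trivial, hx⟩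
    exact ⟨y, Set.mem_iInter.2 hy⟩
  · intro i
    obtain ⟨k, hk⟩ := hqD (Sum.inl i)
    exact Set.disjoint_of_subset_left (Set.iInter_subset _ k) hk

/-! ### Cofinal families of ordinals -/

theorem exists_bound_of_card_lt_cof {ι : Type} {f : ι → Ordinal.{u}} {a : Ordinal.{u}}
    (hι : Cardinal.lift.{u} #ι < a.cof) (hf : ∀ i, f i < a) : ∃ b < a, ∀ i, f i ≤ b :=
  ⟨⨆ i, f i, Ordinal.lift_iSup_lt_of_lt_cof (by simpa using hι) hf,
    fun i => le_ciSup ⟨a, by rintro _ ⟨j, rfl⟩; exact (hf j).le⟩ i⟩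

theorem exists_cofinal_family (a : Ordinal.{u}) :
    ∃ (J : Type u) (t : J → Ordinal.{u}), #J = a.cof ∧ (∀ j, t j < a) ∧ ∀ b < a, ∃ j, b ≤ t j := by
  obtain ⟨T, hT, hTc⟩ := Order.exists_cof_eq a.ToType
  refine ⟨T, fun j => Ordinal.typein (α := a.ToType) (· < ·) j, by rw [hTc, Ordinal.cof_toType],
    fun j => ?_, fun b hb => ?_⟩
  · simpa using Ordinal.typein_lt_type (α := a.ToType) (· < ·) j
  · obtain ⟨x, rfl⟩ := (Ordinal.mem_range_typein_iff (α := a.ToType) (· < ·)).2 (by simpa using hb)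
    obtain ⟨j, hj, hxj⟩ := hT x
    exact ⟨⟨j, hj⟩, by simpa using hxj⟩

theorem exists_cofinal_sequence {a : Ordinal.{u}} (ha : a.cof = ℵ₀) :
    ∃ b : ℕ → Ordinal.{u}, (∀ k, b k < a) ∧ ∀ c < a, ∃ k, c < b k := by
  have hlim : Order.IsSuccLimit a := Ordinal.one_lt_cof_iff.1 (ha ▸ one_lt_aleph0)
  obtain ⟨J, t, hJ, ht, htc⟩ := exists_cofinal_family a
  obtain ⟨e⟩ : Nonempty (ULift.{u} ℕ ≃ J) := by
    rw [← Cardinal.eq, hJ, ha]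
    simp
  refine ⟨fun k => t (e ⟨k⟩), fun k => ht _, fun c hc => ?_⟩
  obtain ⟨j, hj⟩ := htc _ (hlim.succ_lt hc)
  refine ⟨(e.symm j).down, ?_⟩
  change c < t (e (e.symm j))
  rw [e.apply_symm_apply]
  exact Order.succ_le_iff.1 hj

/-! ### Bernstein colourings -/

theorem mk_isClosed_le_continuum (P : Type) [TopologicalSpace P] [SecondCountableTopology P] :
    #{F : Set P // IsClosed F} ≤ 𝔠 := by
  obtain ⟨B, hBc, -, hB⟩ := TopologicalSpace.exists_countable_basis P
  have hinj : Function.Injective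
      (fun F : {F : Set P // IsClosed F} => {s : B | (s : Set P) ⊆ (F : Set P)ᶜ}) := by
    rintro ⟨F, hF⟩ ⟨G, hG⟩ h
    have key : ∀ F G : Set P, IsClosed F →
        {s : B | (s : Set P) ⊆ Fᶜ} = {s : B | (s : Set P) ⊆ Gᶜ} → G ⊆ F := by
      intro F G hF h x hxG
      by_contra hxF
      obtain ⟨s, hs, hxs, hsF⟩ := hB.exists_subset_of_mem_open (show x ∈ Fᶜ from hxF)
        hF.isOpen_compl
      have : (⟨s, hs⟩ : B) ∈ {s : B | (s : Set P) ⊆ Gᶜ} := h ▸ hsF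
      exact this hxs hxG
    exact Subtype.ext ((key G F hG h.symm).antisymm (key F G hF h))
  have h := mk_le_of_injective hinj
  rw [mk_set] at h
  refine h.trans ?_
  have hle : #B ≤ ℵ₀ := mk_le_aleph0_iff.2 hBc.to_subtype
  calc (2 : Cardinal) ^ #B ≤ 2 ^ ℵ₀ := power_le_power_left two_ne_zero hle
    _ = 𝔠 := two_power_aleph0

theorem mk_diff_of_not_countable {F C : Set (ℕ → Bool)} (hF : IsClosed F) (hFu : ¬ F.Countable)
    (hC : C.Countable) : 𝔠 ≤ #(F \ C : Set (ℕ → Bool)) := by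
  have : PolishSpace (ℕ → Bool) := {}
  obtain ⟨f, hfF, -, hf⟩ := hF.exists_nat_bool_injection_of_not_countable hFu
  have h1 : 𝔠 ≤ #F := by
    have := mk_le_of_injective (f := fun x => (⟨f x, hfF ⟨x, rfl⟩⟩ : F))
      (fun x y h => hf (by simpa using h))
    simpa using this
  by_contra! h
  have h2 : #F ≤ #(F \ C : Set (ℕ → Bool)) + #C := by
    refine (mk_le_mk_of_subset ?_).trans (mk_union_le _ _)
    intro x hx
    by_cases hxC : x ∈ C
    · exact Or.inr hxC
    · exact Or.inl ⟨hx, hxC⟩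
  exact (h1.trans h2).not_gt
    (add_lt_of_lt aleph0_le_continuum h ((mk_le_aleph0_iff.2 hC.to_subtype).trans_lt
      aleph0_lt_continuum))

/-- A colouring of the Cantor space by at most `𝔠` colours such that each uncountable closed set
contains points of all colours: the `𝔠` many pairs of an uncountable closed set and a colour are
assigned distinct points by recursion. -/
theorem exists_bernstein_coloring {C : Set (ℕ → Bool)} (hC : C.Countable) {μ : Ordinal.{u}}
    (hμ0 : 0 < μ) (hμ : μ.card ≤ 𝔠) :
    ∃ ρ : (ℕ → Bool) → Ordinal.{u}, (∀ x, ρ x < μ) ∧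
      ∀ F, IsClosed F → ¬ F.Countable → ∀ β < μ, ∃ x ∈ F, x ∉ C ∧ ρ x = β := by
  classical
  let 𝒯 := {F : Set (ℕ → Bool) // IsClosed F ∧ ¬ F.Countable} × μ.ToType
  have hcard : #𝒯 ≤ 𝔠 := by
    have h1 : #{F : Set (ℕ → Bool) // IsClosed F ∧ ¬ F.Countable} ≤ 𝔠 :=
      (mk_subtype_mono fun F h => h.1).trans (mk_isClosed_le_continuum _)
    have h2 : Cardinal.lift.{u} #{F : Set (ℕ → Bool) // IsClosed F ∧ ¬ F.Countable} ≤ 𝔠 := by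
      simpa using Cardinal.lift_le.{u}.2 h1
    simp only [𝒯, mk_prod, mk_toType, Cardinal.lift_uzero]
    exact (mul_le_mul' h2 hμ).trans continuum_mul_self.le
  by_cases hne : Nonempty 𝒯
  swap
  · refine ⟨fun _ => 0, fun _ => hμ0, fun F hF hFu => ?_⟩
    exact absurd ⟨⟨F, hF, hFu⟩, Ordinal.enum (α := μ.ToType) (· < ·) ⟨0, by simpa using hμ0⟩⟩ hne
  obtain ⟨e, he⟩ : ∃ e : (𝔠 : Cardinal.{0}).ord.ToType → 𝒯, Function.Surjective e := by
    have h : Cardinal.lift.{0} #𝒯 ≤ Cardinal.lift.{u} #(𝔠 : Cardinal.{0}).ord.ToType := by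
      simpa using hcard
    obtain ⟨g⟩ := Cardinal.lift_mk_le'.1 h
    exact ⟨Function.invFun g, Function.invFun_surjective g.injective⟩
  have hstep : ∀ a (x : ∀ b, b < a → (ℕ → Bool)),
      ∃ y ∈ (e a).1.1 \ C, ∀ b hb, y ≠ x b hb := by
    intro a x
    by_contra! h
    have h1 := mk_diff_of_not_countable (e a).1.2.1 (e a).1.2.2 hC
    have h2 : (e a).1.1 \ C ⊆ Set.range fun b : Set.Iio a => x b.1 b.2 := by
      intro y hy
      obtain ⟨b, hb, rfl⟩ := h y hy
      exact ⟨⟨b, hb⟩, rfl⟩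
    exact ((h1.trans (mk_le_mk_of_subset h2)).trans mk_range_le).not_gt
      ((mk_Iio_lt a (by simp)).trans_eq (by simp))
  choose next hnext hnext' using hstep
  let pt : (𝔠 : Cardinal.{0}).ord.ToType → (ℕ → Bool) :=
    WellFounded.fix (wellFounded_lt (α := (𝔠 : Cardinal.{0}).ord.ToType)) next
  have hpt : ∀ a, pt a = next a fun b _ => pt b := fun a => WellFounded.fix_eq _ _ a
  have hinj : Function.Injective pt := by
    have key : ∀ a b, a < b → pt b ≠ pt a := by
      intro a b hab
      rw [hpt b]
      exact hnext' b _ a hab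
    intro a b h
    rcases lt_trichotomy a b with hab | hab | hab
    · exact absurd h.symm (key a b hab)
    · exact hab
    · exact absurd h (key b a hab)
  refine ⟨fun x => if h : ∃ a, pt a = x then
    Ordinal.typein (α := μ.ToType) (· < ·) (e h.choose).2 else 0, fun x => ?_, ?_⟩
  · dsimp only
    split_ifs with h
    · simpa using Ordinal.typein_lt_type (α := μ.ToType) (· < ·) (e h.choose).2
    · exact hμ0
  · intro F hF hFu β hβ
    obtain ⟨c, rfl⟩ := (Ordinal.mem_range_typein_iff (α := μ.ToType) (· < ·)).2
      (by simpa using hβ)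
    obtain ⟨a, ha⟩ := he ⟨⟨F, hF, hFu⟩, c⟩
    have h1 := hnext a fun b _ => pt b
    rw [← hpt, ha] at h1
    have h : ∃ b, pt b = pt a := ⟨a, rfl⟩
    refine ⟨pt a, h1.1, h1.2, ?_⟩
    simp only [h, dite_true]
    rw [hinj h.choose_spec, ha]

/-! ### Closed sets modulo countably many pieces -/

theorem Perfect.not_countable {F : Set (ℕ → Bool)} (hF : Perfect F) (hne : F.Nonempty) :
    ¬ F.Countable := by
  let := TopologicalSpace.upgradeIsCompletelyMetrizable (ℕ → Bool)
  obtain ⟨f, hfF, -, hf⟩ := hF.exists_nat_bool_injection hne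
  intro h
  have h1 : #(ℕ → Bool) ≤ #F := mk_le_of_injective (f := fun x => (⟨f x, hfF ⟨x, rfl⟩⟩ : F))
      (fun x y h => hf (by simpa using h))
  have h2 : #F ≤ ℵ₀ := mk_le_aleph0_iff.2 h.to_subtype
  exact ((h1.trans h2).trans_lt aleph0_lt_continuum).ne (by simp)

/-- A Cantor–Bendixson type alternative: a closed set is covered by countably many of the sets
`N a` and a countable set, or it has a nonempty perfect subset in which all `N a` are nowhere
dense. -/
theorem countable_cover_or_exists_perfect {P : Type} [TopologicalSpace P]
    [SecondCountableTopology P] {K : Set P} (hK : IsClosed K) {J : Type} (N : J → Set P) :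
    (∃ (Q : Set P) (A : Set J), Q.Countable ∧ A.Countable ∧ K ⊆ Q ∪ ⋃ a ∈ A, N a) ∨
      ∃ F ⊆ K, Perfect F ∧ F.Nonempty ∧
        ∀ a, ∀ W : Set P, IsOpen W → (W ∩ F).Nonempty → ∃ x ∈ W ∩ F, x ∉ N a := by
  let small : Set P → Prop := fun Y =>
    ∃ (Q : Set P) (A : Set J), Q.Countable ∧ A.Countable ∧ Y ⊆ Q ∪ ⋃ a ∈ A, N a
  have hunion : ∀ {Y Z}, small Y → small Z → small (Y ∪ Z) := by
    rintro Y Z ⟨Q, A, hQ, hA, h⟩ ⟨Q', A', hQ', hA', h'⟩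
    refine ⟨Q ∪ Q', A ∪ A', hQ.union hQ', hA.union hA', Set.union_subset (h.trans ?_)
      (h'.trans ?_)⟩
    · exact Set.union_subset_union Set.subset_union_left
        (Set.biUnion_subset_biUnion_left Set.subset_union_left)
    · exact Set.union_subset_union Set.subset_union_right
        (Set.biUnion_subset_biUnion_left Set.subset_union_right)
  have hmono : ∀ {Y Z}, small Z → Y ⊆ Z → small Y := by
    rintro Y Z ⟨Q, A, hQ, hA, h⟩ hYZ
    exact ⟨Q, A, hQ, hA, hYZ.trans h⟩
  let 𝒲 := {W : Set P | IsOpen W ∧ small (W ∩ K)}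
  obtain ⟨𝒱, h𝒱c, h𝒱, h𝒱W⟩ := TopologicalSpace.isOpen_sUnion_countable 𝒲 fun W hW => hW.1
  have hW : small (⋃₀ 𝒲 ∩ K) := by
    rw [← h𝒱W]
    have h1 : ∀ W : 𝒱, small (W ∩ K) := fun W => (h𝒱 W.2).2
    choose Q A hQ hA h using h1
    have := h𝒱c.to_subtype
    refine ⟨⋃ W, Q W, ⋃ W, A W, Set.countable_iUnion hQ, Set.countable_iUnion hA, ?_⟩
    rintro x ⟨⟨W, hW, hxW⟩, hxK⟩
    rcases h ⟨W, hW⟩ ⟨hxW, hxK⟩ with hx | hx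
    · exact Or.inl (Set.mem_iUnion.2 ⟨_, hx⟩)
    · obtain ⟨a, ha, hx⟩ := Set.mem_iUnion₂.1 hx
      exact Or.inr (Set.mem_iUnion₂.2 ⟨a, Set.mem_iUnion.2 ⟨_, ha⟩, hx⟩)
  have hO : IsOpen (⋃₀ 𝒲) := isOpen_sUnion fun W hW => hW.1
  have hbig : ∀ W, IsOpen W → (W ∩ (K \ ⋃₀ 𝒲)).Nonempty → ¬ small (W ∩ (K \ ⋃₀ 𝒲)) := by
    rintro W hWo ⟨x, hxW, hxK, hx⟩ hs
    refine hx ⟨W, ⟨hWo, hmono (hunion hs hW) ?_⟩, hxW⟩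
    intro y hy
    by_cases hyW : y ∈ ⋃₀ 𝒲
    · exact Or.inr ⟨hyW, hy.2⟩
    · exact Or.inl ⟨hy.1, hy.2, hyW⟩
  by_cases hne : (K \ ⋃₀ 𝒲).Nonempty
  swap
  · left
    refine hmono hW fun x hx => ⟨?_, hx⟩
    by_contra h
    exact hne ⟨x, hx, h⟩
  right
  refine ⟨K \ ⋃₀ 𝒲, Set.sdiff_subset, ⟨hK.sdiff hO, preperfect_iff_nhds.2 ?_⟩, hne, ?_⟩
  · intro x hx U hU
    obtain ⟨V, hVU, hV, hxV⟩ := mem_nhds_iff.1 hU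
    by_contra! h
    refine hbig V hV ⟨x, hxV, hx⟩ ⟨{x}, ∅, Set.countable_singleton x, Set.countable_empty, ?_⟩
    intro y hy
    exact Or.inl (h y ⟨hVU hy.1, hy.2⟩)
  · intro a W hWo hWn
    by_contra! h
    refine hbig W hWo hWn ⟨∅, {a}, Set.countable_empty, Set.countable_singleton a, ?_⟩
    intro y hy
    exact Or.inr (Set.mem_iUnion₂.2 ⟨a, rfl, h y hy⟩)

/-! ### The rank function -/

/-- `IsRankCovered ρ V Y`: countably many of the sets `{x} ∪ (V x ∩ {y | ρ y < ρ x})` cover `Y`.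
These sets are the neighbourhoods of `x` in the topology refined by the rank function `ρ`. -/
def IsRankCovered {P : Type} (ρ : P → Ordinal.{u}) (V : P → Set P) (Y : Set P) : Prop :=
  ∃ A : Set P, A.Countable ∧ ∀ y ∈ Y, ∃ x ∈ A, y = x ∨ (y ∈ V x ∧ ρ y < ρ x)

section

variable {P : Type} {ρ : P → Ordinal.{u}} {V : P → Set P} {Y Z : Set P}

theorem IsRankCovered.mono (h : IsRankCovered ρ V Z) (hYZ : Y ⊆ Z) : IsRankCovered ρ V Y := by
  obtain ⟨A, hA, h⟩ := h
  exact ⟨A, hA, fun y hy => h y (hYZ hy)⟩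

theorem Set.Countable.isRankCovered (h : Y.Countable) : IsRankCovered ρ V Y :=
  ⟨Y, h, fun y hy => ⟨y, hy, Or.inl rfl⟩⟩

theorem isRankCovered_iUnion {J : Type*} [Countable J] {Y : J → Set P}
    (h : ∀ j, IsRankCovered ρ V (Y j)) : IsRankCovered ρ V (⋃ j, Y j) := by
  choose A hA h using h
  refine ⟨⋃ j, A j, Set.countable_iUnion hA, fun y hy => ?_⟩
  obtain ⟨j, hj⟩ := Set.mem_iUnion.1 hy
  obtain ⟨x, hx, hxy⟩ := h j y hj
  exact ⟨x, Set.mem_iUnion.2 ⟨j, hx⟩, hxy⟩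

theorem IsRankCovered.union (hY : IsRankCovered ρ V Y) (hZ : IsRankCovered ρ V Z) :
    IsRankCovered ρ V (Y ∪ Z) := by
  obtain ⟨A, hA, h⟩ := hY
  obtain ⟨B, hB, h'⟩ := hZ
  refine ⟨A ∪ B, hA.union hB, ?_⟩
  rintro y (hy | hy)
  · obtain ⟨x, hx, hxy⟩ := h y hy
    exact ⟨x, Or.inl hx, hxy⟩
  · obtain ⟨x, hx, hxy⟩ := h' y hy
    exact ⟨x, Or.inr hx, hxy⟩

end

theorem perfect_cylinder (x : ℕ → Bool) (m : ℕ) : Perfect (PiNat.cylinder x m) := by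
  refine ⟨?_, preperfect_iff_nhds.2 fun y hy U hU => ?_⟩
  · rw [PiNat.cylinder_eq_pi]
    exact isClosed_set_pi fun i _ => isClosed_discrete _
  · obtain ⟨W, hWU, hW, hyW⟩ := mem_nhds_iff.1 hU
    obtain ⟨k, hk⟩ := exists_cylinder_subset hW hyW
    have h := PiNat.update_mem_cylinder y (max m k) (!y (max m k))
    refine ⟨_, ⟨hWU (hk (PiNat.cylinder_anti y (le_max_right m k) h)), ?_⟩, fun he => ?_⟩
    · rw [← PiNat.mem_cylinder_iff_eq.1 hy]
      exact PiNat.cylinder_anti y (le_max_left m k) h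
    · have := congrFun he (max m k)
      simp at this

/-- The rank function of the space that is constructed. The levels `μ + i`, `i < n`, are the
countable dense sets `D i`. A point `x` outside of them is assigned the least index `i` such that
`x` lies in the `σ`-closed set `⋃ h, S i h`, and takes its rank from a Bernstein colouring, cut off
at `θ i`. The bound `θ i` has countable cofinality, and this makes closed sets contained in
`⋃ h, S i h` Lindelöf, by induction on `i`. -/
theorem exists_rank_function {μ : Ordinal.{u}} (hμ0 : 0 < μ) (hμ : μ.card ≤ 𝔠) (n : ℕ)
    {D : ℕ → Set (ℕ → Bool)} (hDc : ∀ i, (D i).Countable) (hDd : ∀ i, Dense (D i))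
    (hDdisj : ∀ i j, i ≠ j → Disjoint (D i) (D j))
    {ι : Type} [LinearOrder ι] [WellFoundedLT ι] (hι : ∀ i : ι, #(Set.Iio i) < covMeager)
    (hc : ℵ₀ < covMeager) {S : ι → ℕ → Set (ℕ → Bool)} (hS : ∀ i h, IsClosed (S i h))
    {θ : ι → Ordinal.{u}} (hθm : Monotone θ) (hθμ : ∀ i, θ i ≤ μ)
    (hθ : ∀ i, ∃ b : ℕ → Ordinal.{u}, (∀ k, b k < θ i) ∧ ∀ c < θ i, ∃ k, c < b k)
    (hcov : ∀ K, IsClosed K → Disjoint K (⋃ i < n, D i) → ∃ i, K ⊆ ⋃ h, S i h)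
    (hnow : ∀ β < μ, ∃ i, β < θ i ∧ ∀ j < i, ∀ h, interior (S j h) = ∅) :
    ∃ ρ : (ℕ → Bool) → Ordinal.{u}, (∀ x, ρ x < μ + n) ∧
      (∀ β < μ + n, Dense {x | ρ x = β}) ∧
      ∀ V : (ℕ → Bool) → Set (ℕ → Bool), (∀ x, IsOpen (V x) ∧ x ∈ V x) →
        IsRankCovered ρ V Set.univ := by
  classical
  set C : Set (ℕ → Bool) := ⋃ i < n, D i with hCdef
  have hCc : C.Countable :=
    Set.countable_iUnion fun i => Set.countable_iUnion fun _ => hDc i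
  obtain ⟨ρ₀, -, hρ₀⟩ := exists_bernstein_coloring hCc hμ0 hμ
  obtain ⟨i₀, -⟩ := hnow 0 hμ0
  have hidx : ∀ x, ∃ i, x ∉ C → x ∈ (⋃ h, S i h) ∧ ∀ j, x ∈ (⋃ h, S j h) → i ≤ j := by
    intro x
    by_cases hx : x ∈ C
    · exact ⟨i₀, fun h => absurd hx h⟩
    · obtain ⟨i, hi⟩ := hcov {x} isClosed_singleton (Set.disjoint_singleton_left.2 hx)
      have hne : {i | x ∈ ⋃ h, S i h}.Nonempty := ⟨i, hi rfl⟩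
      exact ⟨wellFounded_lt.min _ hne, fun _ => ⟨wellFounded_lt.min_mem _ hne,
        fun j hj => not_lt.1 (wellFounded_lt.not_lt_min {i | x ∈ ⋃ h, S i h} hj)⟩⟩
  choose idx hidx using hidx
  have hθ0 : ∀ i, 0 < θ i := by
    intro i
    obtain ⟨b, hb, -⟩ := hθ i
    exact zero_le.trans_lt (hb 0)
  have hCk : ∀ x ∈ C, ∃ k < n, x ∈ D k := by
    intro x hx
    obtain ⟨k, hk, hxk⟩ := Set.mem_iUnion₂.1 hx
    exact ⟨k, hk, hxk⟩
  choose! lev hlev hxlev using hCk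
  let ρ : (ℕ → Bool) → Ordinal.{u} := fun x =>
    if x ∈ C then μ + lev x else if ρ₀ x < θ (idx x) then ρ₀ x else 0
  have hρC : ∀ x ∈ C, ρ x = μ + lev x := fun x hx => if_pos hx
  have hρn : ∀ x, x ∉ C → ρ x = if ρ₀ x < θ (idx x) then ρ₀ x else 0 := fun x hx => if_neg hx
  have hρθ : ∀ x, x ∉ C → ρ x < θ (idx x) := by
    intro x hx
    rw [hρn x hx]
    split_ifs with h
    · exact h
    · exact hθ0 _
  have hDC : ∀ k < n, D k ⊆ C := fun k hk x hx => Set.mem_iUnion₂.2 ⟨k, hk, hx⟩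
  have hcardpairs : ∀ i : ι, #(Set.Iio i × ℕ) < covMeager := by
    intro i
    rw [mk_prod]
    simpa using mul_lt_of_lt hc.le (hι i) hc
  refine ⟨ρ, fun x => ?_, fun β hβ => ?_, fun V hV => ?_⟩
  · by_cases hx : x ∈ C
    · rw [hρC x hx]
      gcongr
      exact hlev x hx
    · exact ((hρθ x hx).trans_le (hθμ _)).trans_le le_self_add
  · by_cases hβμ : β < μ
    swap
    · obtain ⟨k, rfl⟩ := exists_add_of_le (not_lt.1 hβμ)
      obtain ⟨k, rfl⟩ := Ordinal.lt_omega0.1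
        (((add_lt_add_iff_left μ).1 hβ).trans (Ordinal.natCast_lt_omega0 n))
      have hk : k < n := by
        have := (add_lt_add_iff_left μ).1 hβ
        exact_mod_cast this
      refine (hDd k).mono fun x hx => ?_
      have hxC := hDC k hk hx
      change ρ x = _
      rw [hρC x hxC]
      congr 2
      by_contra hne
      exact Set.disjoint_left.1 (hDdisj _ _ hne) (hxlev x hxC) hx
    · obtain ⟨i, hβi, hi⟩ := hnow β hβμ
      refine dense_iff_inter_open.2 fun W hW ⟨x, hxW⟩ => ?_
      obtain ⟨m, hm⟩ := exists_cylinder_subset hW hxW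
      have hcyl := PiNat.isOpen_cylinder (fun _ : ℕ => Bool) x m
      obtain ⟨E, hEF, hE, hEne, hEd⟩ := exists_perfect_disjoint (perfect_cylinder x m)
        ⟨x, PiNat.self_mem_cylinder x m⟩ (hcardpairs i) hc (fun p => S p.1.1 p.2)
        (fun p => hS _ _) (by
          rintro ⟨⟨j, hj⟩, h⟩ W hW hWne
          by_contra! hsub
          have := interior_maximal hsub (hW.inter hcyl)
          rw [hi j hj h] at this
          obtain ⟨y, hy⟩ := hWne
          exact this hy)
      obtain ⟨y, hyE, hyC, hyβ⟩ := hρ₀ E hE.closed (hE.not_countable hEne) β hβμ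
      refine ⟨y, hm (hEF hyE), ?_⟩
      have hidxi : i ≤ idx y := by
        by_contra! hlt
        obtain ⟨h, hh⟩ := Set.mem_iUnion.1 (hidx y hyC).1
        exact Set.disjoint_left.1 (hEd ⟨⟨idx y, hlt⟩, h⟩) hyE hh
      change ρ y = β
      rw [hρn y hyC, if_pos (by rw [hyβ]; exact hβi.trans_le (hθm hidxi)), hyβ]
  · have claim : ∀ i, ∀ K, IsClosed K → K ⊆ ⋃ h, S i h → IsRankCovered ρ V K := by
      intro i
      induction i using WellFoundedLT.induction with
      | ind i ih =>
      intro K hK hKS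
      obtain ⟨b, hb, hbc⟩ := hθ i
      let O : ℕ → Set (ℕ → Bool) := fun k => ⋃ x ∈ {x | ρ x = b k}, V x
      have hO : ∀ k, IsOpen (O k) := fun k => isOpen_biUnion fun x _ => (hV x).1
      -- Each level `b k` covers everything below it, up to the closed set `K \ O k`.
      have h1 : ∀ k, IsRankCovered ρ V (O k ∩ {y | ρ y < b k}) := by
        intro k
        obtain ⟨A, hAc, hA⟩ := TopologicalSpace.isOpen_iUnion_countable
          (fun x : {x | ρ x = b k} => V x) (fun x => (hV x).1)
        refine ⟨Subtype.val '' A, hAc.image _, ?_⟩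
        rintro y ⟨hyO, hy⟩
        have hy' : y ∈ ⋃ x : {x | ρ x = b k}, V x := by
          obtain ⟨x, hx, hyx⟩ := Set.mem_iUnion₂.1 hyO
          exact Set.mem_iUnion.2 ⟨⟨x, hx⟩, hyx⟩
        rw [← hA] at hy'
        obtain ⟨x, hxA, hyx⟩ := Set.mem_iUnion₂.1 hy'
        exact ⟨x, ⟨x, hxA, rfl⟩, Or.inr ⟨hyx, by rw [x.2]; exact hy⟩⟩
      -- A perfect subset of `K \ O k` without points of smaller index would contain a point of
      -- rank `b k`.
      have h2 : ∀ k, IsRankCovered ρ V (K \ O k) := by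
        intro k
        rcases countable_cover_or_exists_perfect (hK.sdiff (hO k))
          (fun p : Set.Iio i × ℕ => S p.1.1 p.2) with ⟨Q, A, hQ, hA, hsub⟩ | ⟨F, hFK, hF, hFne, hFn⟩
        · have := hA.to_subtype
          refine IsRankCovered.mono (hQ.isRankCovered.union (isRankCovered_iUnion
            (Y := fun a : A => K ∩ S a.1.1.1 a.1.2) fun a => ?_)) fun y hy => ?_
          · exact ih a.1.1.1 a.1.1.2 _ (hK.inter (hS _ _)) fun y hy =>
              Set.mem_iUnion.2 ⟨_, hy.2⟩
          · rcases hsub hy with h | h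
            · exact Or.inl h
            · obtain ⟨a, ha, hya⟩ := Set.mem_iUnion₂.1 h
              exact Or.inr (Set.mem_iUnion.2 ⟨⟨a, ha⟩, hy.1, hya⟩)
        · exfalso
          obtain ⟨E, hEF, hE, hEne, hEd⟩ := exists_perfect_disjoint hF hFne (hcardpairs i) hc
            (fun p => S p.1.1 p.2) (fun p => hS _ _) hFn
          obtain ⟨x, hxE, hxC, hxb⟩ := hρ₀ E hE.closed (hE.not_countable hEne) (b k)
            ((hb k).trans_le (hθμ i))
          have hxK := hFK (hEF hxE)
          have hidxi : i ≤ idx x := by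
            by_contra! hlt
            obtain ⟨h, hh⟩ := Set.mem_iUnion.1 (hidx x hxC).1
            exact Set.disjoint_left.1 (hEd ⟨⟨idx x, hlt⟩, h⟩) hxE hh
          refine hxK.2 (Set.mem_iUnion₂.2 ⟨x, ?_, (hV x).2⟩)
          change ρ x = b k
          rw [hρn x hxC, if_pos (by rw [hxb]; exact (hb k).trans_le (hθm hidxi)), hxb]
      refine IsRankCovered.mono (hCc.isRankCovered.union
        ((isRankCovered_iUnion h1).union (isRankCovered_iUnion h2))) fun y hy => ?_
      by_cases hyC : y ∈ C
      · exact Or.inl hyC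
      right
      obtain ⟨k, hk⟩ := hbc (ρ y)
        ((hρθ y hyC).trans_le (hθm ((hidx y hyC).2 i (hKS hy))))
      by_cases hyO : y ∈ O k
      · exact Or.inl (Set.mem_iUnion.2 ⟨k, hyO, hk⟩)
      · exact Or.inr (Set.mem_iUnion.2 ⟨k, hy, hyO⟩)
    have hW : IsOpen (⋃ c ∈ C, V c) := isOpen_biUnion fun x _ => (hV x).1
    obtain ⟨i, hi⟩ := hcov (⋃ c ∈ C, V c)ᶜ hW.isClosed_compl
      (Set.disjoint_left.2 fun x hx hxC => hx (Set.mem_iUnion₂.2 ⟨x, hxC, (hV x).2⟩))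
    have hC' : IsRankCovered ρ V ((⋃ c ∈ C, V c) \ C) := by
      refine ⟨C, hCc, ?_⟩
      rintro y ⟨hy, hyC⟩
      obtain ⟨c, hcC, hyc⟩ := Set.mem_iUnion₂.1 hy
      refine ⟨c, hcC, Or.inr ⟨hyc, ?_⟩⟩
      rw [hρC c hcC]
      exact ((hρθ y hyC).trans_le (hθμ _)).trans_le le_self_add
    refine IsRankCovered.mono ((hCc.isRankCovered.union hC').union
      (claim i _ hW.isClosed_compl hi)) fun y _ => ?_
    by_cases hyC : y ∈ C
    · exact Or.inl (Or.inl hyC)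
    · by_cases hy : y ∈ ⋃ c ∈ C, V c
      · exact Or.inl (Or.inr ⟨hy, hyC⟩)
      · exact Or.inr hy

/-! ### The topology refined by a rank function -/

/-- The Cantor space with the topology in which a set is a neighbourhood of `x` if it contains `x`
and those points of some ordinary neighbourhood of `x` whose rank is smaller than the rank of `x`.
It is lifted to the universe of the ranks. -/
def RankSpace (_ρ : (ℕ → Bool) → Ordinal.{u}) : Type u := ULift.{u} (ℕ → Bool)

namespace RankSpace

variable {ρ : (ℕ → Bool) → Ordinal.{u}}

/-- The underlying point of the Cantor space. -/
def pt (x : RankSpace ρ) : ℕ → Bool := ULift.down x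

/-- The point of `RankSpace ρ` given by a point of the Cantor space. -/
def of (x : ℕ → Bool) : RankSpace ρ := ULift.up x

theorem pt_injective : Function.Injective (pt : RankSpace ρ → (ℕ → Bool)) :=
  ULift.down_injective

/-- The basic neighbourhood of `x` determined by the cylinder of length `m`. -/
def basicNhd (x : RankSpace ρ) (m : ℕ) : Set (RankSpace ρ) :=
  {y | y = x ∨ (y.pt ∈ PiNat.cylinder x.pt m ∧ ρ y.pt < ρ x.pt)}

theorem self_mem_basicNhd (x : RankSpace ρ) (m : ℕ) : x ∈ basicNhd x m := Or.inl rfl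

theorem basicNhd_anti (x : RankSpace ρ) {m k : ℕ} (h : m ≤ k) : basicNhd x k ⊆ basicNhd x m := by
  rintro y (rfl | ⟨hy, hlt⟩)
  · exact Or.inl rfl
  · exact Or.inr ⟨PiNat.cylinder_anti _ h hy, hlt⟩

instance : TopologicalSpace (RankSpace ρ) where
  IsOpen U := ∀ x ∈ U, ∃ m, basicNhd x m ⊆ U
  isOpen_univ x _ := ⟨0, Set.subset_univ _⟩
  isOpen_inter U V hU hV := by
    rintro x ⟨hxU, hxV⟩
    obtain ⟨m, hm⟩ := hU x hxU
    obtain ⟨k, hk⟩ := hV x hxV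
    exact ⟨max m k, Set.subset_inter ((basicNhd_anti x (le_max_left m k)).trans hm)
      ((basicNhd_anti x (le_max_right m k)).trans hk)⟩
  isOpen_sUnion 𝒰 h𝒰 := by
    rintro x ⟨U, hU, hxU⟩
    obtain ⟨m, hm⟩ := h𝒰 U hU x hxU
    exact ⟨m, hm.trans (Set.subset_sUnion_of_mem hU)⟩

theorem isOpen_iff {U : Set (RankSpace ρ)} : IsOpen U ↔ ∀ x ∈ U, ∃ m, basicNhd x m ⊆ U := Iff.rfl

theorem isOpen_basicNhd (x : RankSpace ρ) (m : ℕ) : IsOpen (basicNhd x m) := by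
  refine isOpen_iff.2 ?_
  rintro y (rfl | ⟨hy, hlt⟩)
  · exact ⟨m, subset_rfl⟩
  · refine ⟨m, ?_⟩
    rintro z (rfl | ⟨hz, hzlt⟩)
    · exact Or.inr ⟨hy, hlt⟩
    · exact Or.inr ⟨by rwa [← PiNat.mem_cylinder_iff_eq.1 hy], hzlt.trans hlt⟩

theorem hasBasis_nhds (x : RankSpace ρ) :
    (nhds x).HasBasis (fun _ : ℕ => True) (basicNhd x) := by
  refine ⟨fun s => ⟨fun hs => ?_, ?_⟩⟩
  · obtain ⟨U, hUs, hU, hxU⟩ := mem_nhds_iff.1 hs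
    obtain ⟨m, hm⟩ := isOpen_iff.1 hU x hxU
    exact ⟨m, trivial, hm.trans hUs⟩
  · rintro ⟨m, -, hm⟩
    exact Filter.mem_of_superset ((isOpen_basicNhd x m).mem_nhds (self_mem_basicNhd x m)) hm

instance : FirstCountableTopology (RankSpace ρ) :=
  ⟨fun x => (hasBasis_nhds x).isCountablyGenerated⟩

theorem continuous_pt : Continuous (pt : RankSpace ρ → (ℕ → Bool)) := by
  refine ⟨fun W hW => isOpen_iff.2 fun x hx => ?_⟩
  obtain ⟨m, hm⟩ := exists_cylinder_subset hW hx
  refine ⟨m, ?_⟩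
  rintro y (rfl | ⟨hy, -⟩)
  · exact hx
  · exact hm hy

instance : T2Space (RankSpace ρ) := T2Space.of_injective_continuous pt_injective continuous_pt

theorem isScatteredSpace : IsScatteredSpace (RankSpace ρ) := by
  intro A hA
  obtain ⟨x, hxA, hx⟩ := WellFounded.has_min
    (InvImage.wf (fun y : RankSpace ρ => ρ y.pt) wellFounded_lt) A hA
  refine ⟨x, hxA, basicNhd x 0, isOpen_basicNhd x 0, ?_⟩
  ext y
  constructor
  · rintro ⟨rfl | ⟨-, hlt⟩, hyA⟩
    · rfl
    · exact absurd hlt (hx y hyA)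
  · rintro rfl
    exact ⟨self_mem_basicNhd _ _, hxA⟩

theorem lindelofSpace (h : ∀ V : (ℕ → Bool) → Set (ℕ → Bool), (∀ x, IsOpen (V x) ∧ x ∈ V x) →
    IsRankCovered ρ V Set.univ) : LindelofSpace (RankSpace ρ) := by
  refine ⟨isLindelof_of_countable_subcover fun {J} U hU hcov => ?_⟩
  have h1 : ∀ x : RankSpace ρ, ∃ j m, basicNhd x m ⊆ U j := by
    intro x
    obtain ⟨j, hj⟩ := Set.mem_iUnion.1 (hcov (Set.mem_univ x))
    obtain ⟨m, hm⟩ := isOpen_iff.1 (hU j) x hj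
    exact ⟨j, m, hm⟩
  choose j m hm using h1
  obtain ⟨A, hA, hAc⟩ := h (fun x => PiNat.cylinder x (m (of x)))
    (fun x => ⟨PiNat.isOpen_cylinder (fun _ : ℕ => Bool) _ _, PiNat.self_mem_cylinder _ _⟩)
  refine ⟨(fun x => j (of x)) '' A, hA.image _, fun y _ => ?_⟩
  obtain ⟨x, hx, hxy⟩ := hAc y.pt trivial
  refine Set.mem_iUnion₂.2 ⟨_, ⟨x, hx, rfl⟩, hm (of x) ?_⟩
  rcases hxy with hxy | hxy
  · exact Or.inl (pt_injective hxy)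
  · exact Or.inr hxy

theorem cbDerivative_eq {l : Ordinal.{u}} (hl : ∀ x, ρ x < l)
    (hd : ∀ β < l, Dense {x | ρ x = β}) (α : Ordinal.{u}) :
    cbDerivative (RankSpace ρ) α = {x | α ≤ ρ x.pt} := by
  unfold cbDerivative
  induction α using Ordinal.limitRecOn with
  | zero => simp
  | add_one α ih =>
    rw [CantorBendixson.iteratedDerivedSet_succ, ih]
    ext x
    constructor
    · rintro ⟨hacc, hx⟩
      obtain ⟨y, ⟨hy, hyα⟩, hyx⟩ := accPt_iff_nhds.1 hacc _
        ((isOpen_basicNhd x 0).mem_nhds (self_mem_basicNhd x 0))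
      rcases hy with hy | hy
      · exact absurd hy hyx
      · exact Order.add_one_le_of_lt (lt_of_le_of_lt hyα hy.2)
    · intro hx
      have hx' : α < ρ x.pt := Order.add_one_le_iff.1 hx
      refine ⟨accPt_iff_nhds.2 fun U hU => ?_, hx'.le⟩
      obtain ⟨m, -, hm⟩ := (hasBasis_nhds x).mem_iff.1 hU
      obtain ⟨y, hyx, hy⟩ := (hd α (hx'.trans (hl _))).inter_open_nonempty _
        (PiNat.isOpen_cylinder (fun _ : ℕ => Bool) x.pt m) ⟨_, PiNat.self_mem_cylinder _ _⟩
      have hy' : ρ y = α := hy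
      refine ⟨of y, ⟨hm (Or.inr ⟨hyx, hy'.trans_lt hx'⟩), hy'.ge⟩, ?_⟩
      rintro rfl
      exact hx'.ne' hy'
  | limit α hα ih =>
    rw [CantorBendixson.iteratedDerivedSet_limit hα]
    ext x
    simp only [Set.mem_iInter, Set.mem_ofPred_eq]
    constructor
    · intro h
      refine le_of_not_gt fun hlt => ?_
      have h1 := h ⟨_, hα.succ_lt hlt⟩
      rw [ih _ (hα.succ_lt hlt)] at h1
      exact (Order.lt_succ (ρ x.pt)).not_ge h1
    · rintro h ⟨b, hb⟩
      rw [ih b hb]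
      exact le_trans (le_of_lt hb) h

theorem scatteredHeight_eq {l : Ordinal.{u}} (hl : ∀ x, ρ x < l)
    (hd : ∀ β < l, Dense {x | ρ x = β}) : scatteredHeight (RankSpace ρ) = l := by
  have hset : {α : Ordinal.{u} | cbDerivative (RankSpace ρ) α = ∅} = Set.Ici l := by
    ext α
    rw [Set.mem_ofPred_eq, cbDerivative_eq hl hd, Set.mem_Ici]
    constructor
    · intro h
      refine le_of_not_gt fun hlt => ?_
      obtain ⟨x, hx⟩ := (hd α hlt).nonempty
      exact Set.eq_empty_iff_forall_notMem.1 h (of x) (ge_of_eq hx)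
    · intro h
      exact Set.eq_empty_of_forall_notMem fun x hx => (hl x.pt).not_ge (h.trans hx)
  rw [scatteredHeight, hset, csInf_Ici]

instance : Uncountable (RankSpace ρ) := by
  have : Uncountable (ℕ → Bool) := by
    rw [← aleph0_lt_mk_iff]
    simpa using aleph0_lt_continuum
  exact (ULift.up_injective (α := ℕ → Bool)).uncountable

end RankSpace

/-! ### Uncountable FLS spaces of given height -/

theorem exists_disjoint_countable_dense : ∃ D : ℕ → Set (ℕ → Bool), (∀ i, (D i).Countable) ∧
    (∀ i, Dense (D i)) ∧ ∀ i j, i ≠ j → Disjoint (D i) (D j) := by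
  -- The points that agree from some place on with a fixed sequence `p i`; different `p i` differ
  -- at infinitely many places.
  let p : ℕ → ℕ → Bool := fun i n => decide (n.unpair.1 = i)
  have htail : ∀ i (s : List Bool) n, s.length ≤ n → s.getD n (p i n) = p i n :=
    fun i s n h => List.getD_eq_default _ _ h
  refine ⟨fun i => Set.range fun (s : List Bool) n => s.getD n (p i n),
    fun i => Set.countable_range _, fun i => ?_, fun i j hij => ?_⟩
  · refine dense_iff_inter_open.2 fun W hW ⟨x, hx⟩ => ?_
    obtain ⟨m, hm⟩ := exists_cylinder_subset hW hx
    refine ⟨_, hm ?_, ⟨List.ofFn fun k : Fin m => x k, rfl⟩⟩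
    intro k hk
    simp [List.getD, hk]
  · refine Set.disjoint_left.2 ?_
    rintro _ ⟨s, rfl⟩ ⟨t, ht⟩
    have h := congrFun ht (Nat.pair i (s.length + t.length))
    have hle := Nat.right_le_pair i (s.length + t.length)
    simp only at h
    rw [htail j t _ (by omega), htail i s _ (by omega)] at h
    simp [p, hij] at h

theorem exists_uncountable_FLS_of_rank {l : Ordinal.{u}}
    (h : ∃ ρ : (ℕ → Bool) → Ordinal.{u}, (∀ x, ρ x < l) ∧ (∀ β < l, Dense {x | ρ x = β}) ∧
      ∀ V : (ℕ → Bool) → Set (ℕ → Bool), (∀ x, IsOpen (V x) ∧ x ∈ V x) →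
        IsRankCovered ρ V Set.univ) :
    ∃ (X : Type u) (_ : TopologicalSpace X), IsFLS X ∧ Uncountable X ∧ scatteredHeight X = l := by
  obtain ⟨ρ, hl, hd, hV⟩ := h
  exact ⟨RankSpace ρ, inferInstance, ⟨inferInstance, inferInstance, RankSpace.lindelofSpace hV,
    RankSpace.isScatteredSpace⟩, inferInstance, RankSpace.scatteredHeight_eq hl hd⟩

theorem add_omega0_lt_of_cof {a μ : Ordinal.{u}} (hμ : ℵ₀ < μ.cof) (ha : a < μ) :
    a + Ordinal.omega0 < μ := by
  have hlim : Order.IsSuccLimit μ := Ordinal.one_lt_cof_iff.1 (one_lt_aleph0.trans hμ)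
  refine lt_of_le_of_ne ?_ fun h => ?_
  · refine le_of_forall_lt fun c hc => ?_
    obtain ⟨n, hn⟩ : ∃ n : ℕ, c ≤ a + n := by
      rcases le_total c a with hca | hac
      · exact ⟨0, by simpa using hca⟩
      · obtain ⟨d, rfl⟩ := exists_add_of_le hac
        obtain ⟨n, rfl⟩ := Ordinal.lt_omega0.1 ((add_lt_add_iff_left a).1 hc)
        exact ⟨n, le_rfl⟩
    refine hn.trans_lt ?_
    clear hn
    induction n with
    | zero => simpa using ha
    | succ n ih =>
      rw [Nat.cast_succ, ← add_assoc]
      exact hlim.succ_lt ih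
  · rw [← h, Ordinal.cof_add _ Ordinal.omega0_ne_zero, Ordinal.cof_omega0] at hμ
    exact hμ.false

theorem exists_uncountable_FLS_of_cof_eq_aleph0 {μ : Ordinal.{u}} (hμ : μ.card ≤ 𝔠)
    (hcof : μ.cof = ℵ₀) (n : ℕ) (hc : ℵ₀ < covMeager) :
    ∃ (X : Type u) (_ : TopologicalSpace X),
      IsFLS X ∧ Uncountable X ∧ scatteredHeight X = μ + n := by
  obtain ⟨D, hDc, hDd, hD⟩ := exists_disjoint_countable_dense
  have hμ0 : 0 < μ := by
    rw [← Ordinal.cof_pos, hcof]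
    exact aleph0_pos
  refine exists_uncountable_FLS_of_rank (exists_rank_function hμ0 hμ n hDc hDd hD (ι := Unit)
    (fun i => ?_) hc (S := fun _ _ => Set.univ) (fun _ _ => isClosed_univ) (θ := fun _ => μ)
    monotone_const (fun _ => le_rfl) (fun _ => exists_cofinal_sequence hcof) (fun K _ _ => ?_)
    fun β hβ => ⟨(), hβ, fun j hj => absurd hj (lt_irrefl j)⟩)
  · have : IsEmpty (Set.Iio i) := ⟨fun j => lt_irrefl i j.2⟩
    rw [mk_eq_zero]
    exact aleph0_pos.trans hc
  · exact ⟨(), fun x _ => Set.mem_iUnion.2 ⟨0, trivial⟩⟩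

/-- If `cf(μ) = 𝔡 = cov(ℳ)`, the closed sets disjoint from a countable dense set `C` are exhausted
by `𝔡` many `σ`-closed sets, indexed by a dominating family, and fewer than `𝔡` of these do not
cover any nonempty open set. -/
theorem exists_uncountable_FLS_of_cof_eq_dominatingNumber {μ : Ordinal.{u}} (hμ : μ.card ≤ 𝔠)
    (hdc : dominatingNumber = covMeager) (hd : ℵ₀ < dominatingNumber)
    (hcof : μ.cof = Cardinal.lift.{u} dominatingNumber) {n : ℕ} (hn : n ≠ 0) :
    ∃ (X : Type u) (_ : TopologicalSpace X),
      IsFLS X ∧ Uncountable X ∧ scatteredHeight X = μ + n := by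
  obtain ⟨D, hDc, hDd, hD⟩ := exists_disjoint_countable_dense
  have hμω : ℵ₀ < μ.cof := by
    rw [hcof]
    simpa using hd
  have hμ0 : 0 < μ := Ordinal.cof_pos.1 (aleph0_pos.trans hμω)
  let ι : Type := dominatingNumber.ord.ToType
  have hιc : #ι = dominatingNumber := mk_ord_toType _
  have hIio : ∀ i : ι, #(Set.Iio i) < dominatingNumber := fun i => by
    simpa [ι] using mk_Iio_lt i (by simp [ι])
  have hIic : ∀ i : ι, #(Set.Iic i) < dominatingNumber := fun i => by
    rw [← Set.Iio_insert]
    exact mk_insert_le.trans_lt (add_lt_of_lt hd.le (hIio i) (one_lt_aleph0.trans hd))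
  obtain ⟨𝒟, h𝒟, h𝒟c⟩ := exists_dominating_family
  obtain ⟨g⟩ : Nonempty (ι ≃ 𝒟) := by
    rw [← Cardinal.eq, h𝒟c, hιc]
  obtain ⟨J, t, hJ, ht, htc⟩ := exists_cofinal_family μ
  obtain ⟨e⟩ : Nonempty (ι ≃ J) := by
    rw [← Cardinal.lift_mk_eq', hιc, hJ, hcof]
    simp
  let s : ι → Ordinal.{u} := fun i => ⨆ j : Set.Iic i, t (e j)
  have hbdd : ∀ i : ι, BddAbove (Set.range fun j : Set.Iic i => t (e j)) := fun i =>
    ⟨μ, by rintro _ ⟨j, rfl⟩; exact (ht _).le⟩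
  have hsμ : ∀ i, s i < μ := fun i =>
    Ordinal.lift_iSup_lt_of_lt_cof (by simpa [hcof] using hIic i) fun j => ht _
  have hts : ∀ i, t (e i) ≤ s i := fun i =>
    le_ciSup (hbdd i) (⟨i, Set.self_mem_Iic⟩ : Set.Iic i)
  have hsm : Monotone s := fun i j hij =>
    ciSup_le' fun k => le_ciSup (hbdd j) (⟨k, le_trans k.2 hij⟩ : Set.Iic j)
  set C : Set (ℕ → Bool) := ⋃ i < n, D i with hCdef
  have hCc : C.Countable :=
    Set.countable_iUnion fun i => Set.countable_iUnion fun _ => hDc i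
  have hCd : Dense C := (hDd 0).mono fun x hx =>
    Set.mem_iUnion₂.2 ⟨0, Nat.pos_of_ne_zero hn, hx⟩
  obtain ⟨c, hc⟩ := hCc.exists_eq_range hCd.nonempty
  let S : ι → ℕ → Set (ℕ → Bool) := fun i m =>
    {x | ∀ k, x ∉ PiNat.cylinder (c k) (max ((g i : ℕ → ℕ) k) m)}
  have hS : ∀ i m, IsClosed (S i m) := by
    intro i m
    have : S i m = ⋂ k, (PiNat.cylinder (c k) (max ((g i : ℕ → ℕ) k) m))ᶜ := by
      ext x
      simp [S]
    rw [this]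
    exact isClosed_iInter fun k =>
      (PiNat.isOpen_cylinder (fun _ : ℕ => Bool) _ _).isClosed_compl
  have hSC : ∀ i m, Disjoint (S i m) C := by
    intro i m
    rw [hc]
    refine Set.disjoint_left.2 ?_
    rintro _ hx ⟨k, rfl⟩
    exact hx k (PiNat.self_mem_cylinder _ _)
  refine exists_uncountable_FLS_of_rank (exists_rank_function hμ0 hμ n hDc hDd hD (ι := ι)
    (fun i => hdc ▸ hIio i) (hdc ▸ hd) hS (θ := fun i => s i + Ordinal.omega0)
    (fun i j hij => by dsimp only; gcongr; exact hsm hij)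
    (fun i => (add_omega0_lt_of_cof hμω (hsμ i)).le)
    (fun i => exists_cofinal_sequence (by
      rw [Ordinal.cof_add _ Ordinal.omega0_ne_zero, Ordinal.cof_omega0]))
    (fun K hK hKC => ?_) fun β hβ => ?_)
  · have h1 : ∀ k, ∃ m, PiNat.cylinder (c k) m ⊆ Kᶜ := fun k =>
      exists_cylinder_subset hK.isOpen_compl fun hk =>
        Set.disjoint_left.1 hKC hk (by rw [← hCdef, hc]; exact ⟨k, rfl⟩)
    choose f hf using h1
    obtain ⟨d, hd, hfd⟩ := h𝒟 f
    obtain ⟨m, hm⟩ := hfd.exists_le_max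
    refine ⟨g.symm ⟨d, hd⟩, fun x hx => Set.mem_iUnion.2 ⟨m, fun k hxk => ?_⟩⟩
    refine hf k (PiNat.cylinder_anti _ ?_ hxk) hx
    simpa using hm k
  · obtain ⟨j, hj⟩ := htc β hβ
    refine ⟨e.symm j, ?_, fun i _ m => ?_⟩
    · have := hts (e.symm j)
      rw [e.apply_symm_apply] at this
      exact (hj.trans this).trans_lt (lt_add_of_pos_right _ Ordinal.omega0_pos)
    · by_contra hne
      obtain ⟨x, hx, hxC⟩ := hCd.inter_open_nonempty _ isOpen_interior
        (Set.nonempty_iff_ne_empty.2 hne)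
      exact Set.disjoint_left.1 (hSC i m) (interior_subset hx) hxC

/-! ### Cardinality of FLS spaces -/

theorem exists_antitone_open_basis (X : Type u) [TopologicalSpace X] [FirstCountableTopology X] :
    ∃ U : X → ℕ → Set X, (∀ x n, IsOpen (U x n)) ∧ (∀ x n, x ∈ U x n) ∧ (∀ x, Antitone (U x)) ∧
      ∀ x W, IsOpen W → x ∈ W → ∃ n, U x n ⊆ W := by
  have h := fun x : X => (nhds x).exists_antitone_basis
  choose B hB using h
  refine ⟨fun x n => interior (B x n), fun x n => isOpen_interior,
    fun x n => mem_interior_iff_mem_nhds.2 ((hB x).mem n),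
    fun x m n hmn => interior_mono ((hB x).antitone hmn), fun x W hW hx => ?_⟩
  obtain ⟨n, hn⟩ := (hB x).mem_iff.1 (hW.mem_nhds hx)
  exact ⟨n, interior_subset.trans hn⟩

/-- Terms built from a constant, one operation of countable arity, and `𝔠` many further operations
of countable arity. -/
abbrev CountableTerm : Type :=
  WType (α := Option (Option (ℕ → ℕ))) fun a => Option.elim a Empty fun _ => ℕ

theorem mk_countableTerm_le : #CountableTerm ≤ 𝔠 := by
  refine WType.cardinalMk_le_of_le' ?_
  have h1 : ∀ a : Option (Option (ℕ → ℕ)),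
      (𝔠 : Cardinal.{0}) ^ #(Option.elim a Empty fun _ => ℕ) ≤ 𝔠 := by
    rintro (_ | a)
    · simpa using one_lt_aleph0.le.trans aleph0_le_continuum
    · simp
  refine (sum_le_sum _ _ fun a => by simpa using h1 a).trans ?_
  rw [sum_const', mk_option, mk_option]
  have h2 : #(ℕ → ℕ) = 𝔠 := by simp
  rw [h2]
  have h3 : (𝔠 : Cardinal.{0}) + 1 + 1 = 𝔠 := by
    rw [add_one_eq aleph0_le_continuum, add_one_eq aleph0_le_continuum]
  simp [h3]

/-- A special case of Arhangel'skii's theorem: the closure of a point under limits of sequences and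
under a choice of points outside of countable unions of basic open sets is closed, hence Lindelöf,
and therefore is everything. -/
theorem mk_le_continuum_of_lindelof (X : Type u) [TopologicalSpace X] [T2Space X]
    [FirstCountableTopology X] [LindelofSpace X] : #X ≤ 𝔠 := by
  classical
  rcases isEmpty_or_nonempty X with hX | ⟨⟨x₀⟩⟩
  · simp
  obtain ⟨U, hUo, hUm, -, hUb⟩ := exists_antitone_open_basis X
  let op : (Σ a : Option (Option (ℕ → ℕ)), (Option.elim a Empty fun _ => ℕ) → X) → X
    | ⟨none, _⟩ => x₀
    | ⟨some none, (s : ℕ → X)⟩ =>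
      if h : ∃ x, Filter.Tendsto s Filter.atTop (nhds x) then h.choose else x₀
    | ⟨some (some f), (s : ℕ → X)⟩ =>
      if h : ∃ y, ∀ i : ℕ, y ∉ U (s i) (f i) then h.choose else x₀
  let F : CountableTerm → X := WType.elim X op
  have hFlim : ∀ (w : ℕ → CountableTerm) x,
      Filter.Tendsto (fun i => F (w i)) Filter.atTop (nhds x) → ∃ v, F v = x := by
    intro w x hx
    refine ⟨WType.mk (some none) w, ?_⟩
    have h : ∃ x, Filter.Tendsto (fun i => F (w i)) Filter.atTop (nhds x) := ⟨x, hx⟩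
    have h1 : F (WType.mk (some none) w) = h.choose := dif_pos h
    rw [h1]
    exact tendsto_nhds_unique h.choose_spec hx
  have hFout : ∀ (w : ℕ → CountableTerm) (f : ℕ → ℕ),
      (∃ y, ∀ i, y ∉ U (F (w i)) (f i)) → ∃ v, ∀ i, F v ∉ U (F (w i)) (f i) := by
    intro w f h
    refine ⟨WType.mk (some (some f)) w, ?_⟩
    have h1 : F (WType.mk (some (some f)) w) = h.choose := dif_pos h
    rw [h1]
    exact h.choose_spec
  have hclosed : IsClosed (Set.range F) := by
    refine isClosed_of_closure_subset fun x hx => ?_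
    obtain ⟨s, hs, hsx⟩ := mem_closure_iff_seq_limit.1 hx
    choose w hw using hs
    exact hFlim w x (by simpa only [hw] using hsx)
  have hsurj : Function.Surjective F := by
    intro p
    by_contra hp
    have h1 : ∀ x, ∃ n, x ≠ p → U x n ⊆ {p}ᶜ := by
      intro x
      by_cases hx : x = p
      · exact ⟨0, fun h => absurd hx h⟩
      · obtain ⟨n, hn⟩ := hUb x {p}ᶜ isOpen_compl_singleton hx
        exact ⟨n, fun _ => hn⟩
    choose n hn using h1
    obtain ⟨T, hTc, hTF, hT⟩ := hclosed.isLindelof.elim_nhds_subcover (fun x => U x (n x))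
      (fun x _ => (hUo x _).mem_nhds (hUm x _))
    have hTne : T.Nonempty := by
      obtain ⟨x, hx, -⟩ := Set.mem_iUnion₂.1
        (hT (⟨WType.mk none Empty.elim, rfl⟩ : x₀ ∈ Set.range F))
      exact ⟨x, hx⟩
    obtain ⟨s, rfl⟩ := hTc.exists_eq_range hTne
    have hs : ∀ i, ∃ w, F w = s i := fun i => hTF _ ⟨i, rfl⟩
    choose w hw using hs
    obtain ⟨v, hv⟩ := hFout w (fun i => n (s i)) ⟨p, fun i hpi => by
      rw [hw] at hpi
      exact hn (s i) (fun h => hp ⟨w i, (hw i).trans h⟩) hpi rfl⟩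
    obtain ⟨x, ⟨i, rfl⟩, hx⟩ := Set.mem_iUnion₂.1 (hT ⟨v, rfl⟩)
    exact hv i (by rwa [hw])
  have h := mk_le_of_surjective (α := ULift.{u} CountableTerm) (f := fun w => F w.down)
    fun x => by
      obtain ⟨w, hw⟩ := hsurj x
      exact ⟨⟨w⟩, hw⟩
  refine h.trans ?_
  rw [mk_uLift]
  simpa using Cardinal.lift_le.{u}.2 mk_countableTerm_le

/-! ### Derivatives of FLS spaces -/

section

variable {X : Type u} [TopologicalSpace X]

theorem isClosed_cbDerivative (α : Ordinal.{u}) : IsClosed (cbDerivative X α) :=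
  CantorBendixson.isClosed_iteratedDerivedSet isClosed_univ α

theorem cbDerivative_antitone : Antitone (cbDerivative X) :=
  CantorBendixson.iteratedDerivedSet_antitone _

theorem card_scatteredHeight_le (hX : IsScatteredSpace X) : (scatteredHeight X).card ≤ #X := by
  have h : ∀ α : (scatteredHeight X).ToType,
      ∃ x, x ∈ cbDerivative X (Ordinal.typein (α := (scatteredHeight X).ToType) (· < ·) α) ∧
        x ∉ cbDerivative X (Ordinal.typein (α := (scatteredHeight X).ToType) (· < ·) α + 1) := fun α =>
    (lt_scatteredHeight_iff hX _).1 (by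
      simpa using Ordinal.typein_lt_type (α := (scatteredHeight X).ToType) (· < ·) α)
  choose f hf hf' using h
  have key : ∀ a b : (scatteredHeight X).ToType, a < b → f a ≠ f b := by
    intro a b hab he
    refine hf' a (he ▸ cbDerivative_antitone ?_ (hf b))
    exact Order.add_one_le_of_lt
      ((Ordinal.typein_lt_typein (α := (scatteredHeight X).ToType) (· < ·)).2 hab)
  have hinj : Function.Injective f := by
    intro a b h
    rcases lt_trichotomy a b with hab | hab | hab
    · exact absurd h (key a b hab)
    · exact hab
    · exact absurd h.symm (key b a hab)
  simpa using mk_le_of_injective hinj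

theorem exists_seq_of_disjoint_cbDerivative [LindelofSpace X] {μ : Ordinal.{u}}
    (hμ : Order.IsSuccLimit μ) {K : Set X} (hK : IsClosed K) (hKμ : Disjoint K (cbDerivative X μ)) :
    ∃ a : ℕ → Ordinal.{u}, (∀ k, a k < μ) ∧ ∀ x ∈ K, ∃ k, x ∉ cbDerivative X (a k) := by
  have : Nonempty (Set.Iio μ) := ⟨⟨0, hμ.bot_lt⟩⟩
  obtain ⟨f, hf⟩ := hK.isLindelof.indexed_countable_subcover
    (fun b : Set.Iio μ => (cbDerivative X b.1)ᶜ)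
    (fun b => (isClosed_cbDerivative _).isOpen_compl) (by
      intro x hx
      have h := Set.disjoint_left.1 hKμ hx
      rw [cbDerivative, CantorBendixson.iteratedDerivedSet_limit hμ, Set.mem_iInter] at h
      push Not at h
      obtain ⟨b, hb⟩ := h
      exact Set.mem_iUnion.2 ⟨b, hb⟩)
  refine ⟨fun k => f k, fun k => (f k).2, fun x hx => ?_⟩
  obtain ⟨k, hk⟩ := Set.mem_iUnion.1 (hf hx)
  exact ⟨k, hk⟩

theorem exists_disjoint_cbDerivative_of_cof [LindelofSpace X] {μ : Ordinal.{u}}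
    (hμ : ℵ₀ < μ.cof) {K : Set X} (hK : IsClosed K) (hKμ : Disjoint K (cbDerivative X μ)) :
    ∃ α < μ, Disjoint K (cbDerivative X α) := by
  obtain ⟨a, ha, haK⟩ := exists_seq_of_disjoint_cbDerivative
    (Ordinal.one_lt_cof_iff.1 (one_lt_aleph0.trans hμ)) hK hKμ
  obtain ⟨α, hα, hb⟩ := exists_bound_of_card_lt_cof (by simpa using hμ) ha
  refine ⟨α, hα, Set.disjoint_left.2 fun x hx hxα => ?_⟩
  obtain ⟨k, hk⟩ := haK x hx
  exact hk (cbDerivative_antitone (hb k) hxα)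

theorem cof_scatteredHeight_le [LindelofSpace X] (hX : IsScatteredSpace X) :
    (scatteredHeight X).cof ≤ ℵ₀ := by
  by_contra! h
  obtain ⟨α, hα, hd⟩ := exists_disjoint_cbDerivative_of_cof h (isClosed_univ (X := X))
    (by rw [cbDerivative_scatteredHeight hX]; exact disjoint_bot_right)
  obtain ⟨x, hx, -⟩ := (lt_scatteredHeight_iff hX α).1 hα
  exact Set.disjoint_left.1 hd trivial hx

theorem countable_of_disjoint_cbDerivative_succ [LindelofSpace X] {α : Ordinal.{u}} {K : Set X}
    (hK : IsClosed K) (hKα : K ⊆ cbDerivative X α) (hd : Disjoint K (cbDerivative X (α + 1))) :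
    K.Countable := by
  have h : ∀ x, ∃ U : Set X, x ∈ K → U ∈ nhds x ∧ ∀ y ∈ U, y ∈ cbDerivative X α → y = x := by
    intro x
    by_cases hx : x ∈ K
    · have h := Set.disjoint_left.1 hd hx
      rw [cbDerivative, CantorBendixson.iteratedDerivedSet_succ] at h
      have hacc : ¬ AccPt x (Filter.principal (cbDerivative X α)) := fun hacc => h ⟨hacc, hKα hx⟩
      rw [accPt_iff_nhds] at hacc
      push Not at hacc
      obtain ⟨U, hU, hUx⟩ := hacc
      exact ⟨U, fun _ => ⟨hU, fun y hy hyα => hUx y ⟨hy, hyα⟩⟩⟩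
    · exact ⟨∅, fun h => absurd h hx⟩
  choose U hU using h
  obtain ⟨T, hT, hTK, hcov⟩ := hK.isLindelof.elim_nhds_subcover U fun x hx => (hU x hx).1
  refine hT.mono fun y hy => ?_
  obtain ⟨x, hxT, hyx⟩ := Set.mem_iUnion₂.1 (hcov hy)
  rwa [(hU x (hTK x hxT)).2 y hyx (hKα hy)]

/-- If `ω₁ < 𝔟`, then countability passes from `X^(α+1)` to `X^(α)`: among `ω₁` isolated points of
`X^(α)`, uncountably many would be outside of one neighbourhood of `X^(α+1)`. -/
theorem countable_cbDerivative_of_succ [T2Space X] [FirstCountableTopology X] [LindelofSpace X]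
    (hb : ℵ₁ < unboundingNumber) {α : Ordinal.{u}} (h : (cbDerivative X (α + 1)).Countable) :
    (cbDerivative X α).Countable := by
  obtain ⟨U, hUo, hUm, hUa, hUb⟩ := exists_antitone_open_basis X
  rcases (cbDerivative X (α + 1)).eq_empty_or_nonempty with hC | hC
  · exact countable_of_disjoint_cbDerivative_succ (isClosed_cbDerivative α) subset_rfl
      (by rw [hC]; exact disjoint_bot_right)
  obtain ⟨c, hc⟩ := h.exists_eq_range hC
  by_contra hunc
  have hunc' : ¬ (cbDerivative X α \ cbDerivative X (α + 1)).Countable := fun h' =>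
    hunc ((h'.union h).mono fun x hx => by
      by_cases hx' : x ∈ cbDerivative X (α + 1)
      · exact Or.inr hx'
      · exact Or.inl ⟨hx, hx'⟩)
  have hle : ℵ₁ ≤ #(cbDerivative X α \ cbDerivative X (α + 1) : Set X) := by
    rw [← succ_aleph0, Order.succ_le_iff]
    refine lt_of_not_ge fun h' => hunc' ?_
    exact Set.countable_coe_iff.1 (mk_le_aleph0_iff.1 h')
  obtain ⟨B, hBsub, hB⟩ := le_mk_iff_exists_subset.1 hle
  have hf : ∀ x k, ∃ n, x ∈ B → x ∉ U (c k) n := by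
    intro x k
    by_cases hx : x ∈ B
    · obtain ⟨n, hn⟩ := hUb (c k) {x}ᶜ isOpen_compl_singleton (by
        rintro rfl
        exact (hBsub hx).2 (hc ▸ ⟨k, rfl⟩))
      exact ⟨n, fun _ h => hn h rfl⟩
    · exact ⟨0, fun h => absurd h hx⟩
  choose f hf using hf
  have hcard : #(f '' B) < unboundingNumber := by
    rw [← Cardinal.lift_lt.{0, u}]
    refine (mk_image_le_lift (f := f) (s := B)).trans_lt ?_
    rw [hB]
    have := Cardinal.lift_lt.{0, u}.2 hb
    simpa using this
  obtain ⟨g, hg⟩ := exists_eventuallyDominated_of_card_lt hcard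
  have hZ : ∀ m, (cbDerivative X α \ ⋃ k, U (c k) (max (g k) m)).Countable := by
    intro m
    refine countable_of_disjoint_cbDerivative_succ
      ((isClosed_cbDerivative α).sdiff (isOpen_iUnion fun k => hUo _ _)) Set.sdiff_subset ?_
    rw [hc]
    refine Set.disjoint_left.2 ?_
    rintro _ ⟨-, hx⟩ ⟨k, rfl⟩
    exact hx (Set.mem_iUnion.2 ⟨k, hUm _ _⟩)
  have hBc : B.Countable := by
    refine (Set.countable_iUnion hZ).mono fun x hx => ?_
    obtain ⟨m, hm⟩ := (hg _ ⟨x, hx, rfl⟩).exists_le_max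
    refine Set.mem_iUnion.2 ⟨m, (hBsub hx).1, fun h => ?_⟩
    obtain ⟨k, hk⟩ := Set.mem_iUnion.1 h
    exact hf x k hx (hUa _ (hm k) hk)
  have := mk_le_aleph0_iff.2 hBc.to_subtype
  rw [hB] at this
  exact this.not_gt aleph0_lt_aleph_one

theorem countable_cbDerivative_of_add_nat [T2Space X] [FirstCountableTopology X] [LindelofSpace X]
    (hb : ℵ₁ < unboundingNumber) {α : Ordinal.{u}} (n : ℕ)
    (h : (cbDerivative X (α + n)).Countable) : (cbDerivative X α).Countable := by
  induction n with
  | zero => simpa using h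
  | succ n ih =>
    refine ih (countable_cbDerivative_of_succ hb ?_)
    rwa [add_assoc, ← Nat.cast_succ]

/-- If `X^(μ)` is countable and `cf(μ)` is uncountable, then mapping `g` to a bound for the ranks
outside of the neighbourhood of `X^(μ)` coded by `g` shows that `cf(μ)` lies between `𝔟` and
`𝔡`. -/
theorem cof_eq_dominatingNumber [T2Space X] [FirstCountableTopology X] [LindelofSpace X]
    (hX : IsScatteredSpace X) (hbd : unboundingNumber = dominatingNumber)
    (hd : ℵ₀ < dominatingNumber) {μ : Ordinal.{u}} (hμ : ℵ₀ < μ.cof) (hμX : μ ≤ scatteredHeight X)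
    (h : (cbDerivative X μ).Countable) : μ.cof = Cardinal.lift.{u} dominatingNumber := by
  obtain ⟨U, hUo, hUm, hUa, hUb⟩ := exists_antitone_open_basis X
  have hlim : Order.IsSuccLimit μ := Ordinal.one_lt_cof_iff.1 (one_lt_aleph0.trans hμ)
  have hpt : ∀ ξ < μ, ∃ x, x ∈ cbDerivative X ξ ∧ x ∉ cbDerivative X μ := by
    intro ξ hξ
    obtain ⟨x, hx, hx'⟩ := (lt_scatteredHeight_iff hX ξ).1 (hξ.trans_le hμX)
    exact ⟨x, hx, fun h => hx' (cbDerivative_antitone (Order.add_one_le_of_lt hξ) h)⟩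
  rcases (cbDerivative X μ).eq_empty_or_nonempty with hC | hC
  · obtain ⟨α, hα, hdis⟩ := exists_disjoint_cbDerivative_of_cof hμ (isClosed_univ (X := X))
      (by rw [hC]; exact disjoint_bot_right)
    obtain ⟨x, hx, -⟩ := hpt α hα
    exact absurd hx (Set.disjoint_left.1 hdis trivial)
  obtain ⟨c, hc⟩ := h.exists_eq_range hC
  let K : (ℕ → ℕ) → Set X := fun g => (⋃ k, U (c k) (g k))ᶜ
  have hK : ∀ g, ∃ α < μ, Disjoint (K g) (cbDerivative X α) := by
    intro g
    refine exists_disjoint_cbDerivative_of_cof hμ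
      (isOpen_iUnion fun k => hUo _ _).isClosed_compl ?_
    rw [hc]
    refine Set.disjoint_left.2 ?_
    rintro _ hx ⟨k, rfl⟩
    exact hx (Set.mem_iUnion.2 ⟨k, hUm _ _⟩)
  choose α hα hαK using hK
  have hf : ∀ x, x ∉ cbDerivative X μ → ∃ f : ℕ → ℕ, ∀ g, (∀ k, f k ≤ g k) → x ∈ K g := by
    intro x hx
    have h1 : ∀ k, ∃ n, U (c k) n ⊆ {x}ᶜ := fun k =>
      hUb (c k) {x}ᶜ isOpen_compl_singleton (by
        rintro rfl
        exact hx (hc ▸ ⟨k, rfl⟩))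
    choose f hf using h1
    refine ⟨f, fun g hfg hxg => ?_⟩
    obtain ⟨k, hk⟩ := Set.mem_iUnion.1 hxg
    exact hf k (hUa _ (hfg k) hk) rfl
  refine le_antisymm (le_of_not_gt fun hlt => ?_) (le_of_not_gt fun hlt => ?_)
  · obtain ⟨𝒟, h𝒟, h𝒟c⟩ := exists_dominating_family
    have hcard : #(𝒟 × ℕ) = dominatingNumber := by
      rw [mk_prod]
      simpa [h𝒟c] using mul_eq_left hd.le hd.le aleph0_ne_zero
    obtain ⟨b, hb, hbα⟩ := exists_bound_of_card_lt_cof (ι := 𝒟 × ℕ) (by rwa [hcard])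
      (fun p => hα fun k => max ((p.1 : ℕ → ℕ) k) p.2)
    obtain ⟨x, hx, hxμ⟩ := hpt b hb
    obtain ⟨f, hf⟩ := hf x hxμ
    obtain ⟨d, hd, hfd⟩ := h𝒟 f
    obtain ⟨m, hm⟩ := hfd.exists_le_max
    exact Set.disjoint_left.1 (hαK _) (hf _ hm)
      (cbDerivative_antitone (hbα (⟨d, hd⟩, m)) hx)
  · obtain ⟨J, t, hJ, ht, htc⟩ := exists_cofinal_family μ
    have hx := fun j => hpt (t j) (ht j)
    choose x hx hxμ using hx
    have hf := fun j => hf (x j) (hxμ j)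
    choose f hf using hf
    have hcard : #(Set.range f) < unboundingNumber := by
      rw [hbd, ← Cardinal.lift_lt.{0, u}]
      refine mk_range_le_lift.trans_lt ?_
      rw [hJ]
      simpa using hlt
    obtain ⟨g, hg⟩ := exists_eventuallyDominated_of_card_lt hcard
    obtain ⟨b, hb, hbα⟩ := exists_bound_of_card_lt_cof (ι := ℕ) (by simpa using hμ)
      (fun m => hα fun k => max (g k) m)
    obtain ⟨j, hj⟩ := htc b hb
    obtain ⟨m, hm⟩ := (hg _ ⟨j, rfl⟩).exists_le_max
    exact Set.disjoint_left.1 (hαK _) (hf j _ hm)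
      (cbDerivative_antitone ((hbα m).trans hj) (hx j))

end

/-! ### Consequences of Martin's Axiom -/

theorem isNowhereDense_singleton_baire (z : ℕ → ℕ) : IsNowhereDense ({z} : Set (ℕ → ℕ)) := by
  refine Set.eq_empty_of_forall_notMem fun w hw => ?_
  rw [closure_singleton] at hw
  obtain ⟨m, hm⟩ := exists_cylinder_subset isOpen_interior hw
  have h1 := interior_subset (hm (PiNat.update_mem_cylinder w m (z m + 1)))
  have h2 := congrFun (Set.mem_singleton_iff.1 h1) m
  simp at h2

theorem covMeager_le_continuum : covMeager ≤ 𝔠 := by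
  have h : covMeager ≤ #(Set.range fun z : ℕ → ℕ => ({z} : Set (ℕ → ℕ))) := by
    refine csInf_le' ⟨_, ?_, ?_, rfl⟩
    · rintro _ ⟨z, rfl⟩
      exact isNowhereDense_singleton_baire z
    · exact Set.eq_univ_of_forall fun z => ⟨{z}, ⟨z, rfl⟩, rfl⟩
  refine h.trans (mk_range_le.trans ?_)
  simp

/-- Hechler forcing: the condition `⟨n, g⟩` fixes the first `n` values of the generic function to be
those of `g`, and promises that the generic function dominates `g`. -/
structure HechlerCondition where
  /-- The length of the fixed part. -/
  len : ℕ
  /-- The fixed part, continued by the promise. -/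
  fn : ℕ → ℕ

namespace HechlerCondition

instance : PartialOrder HechlerCondition where
  le p q := q.len ≤ p.len ∧ (∀ i, q.fn i ≤ p.fn i) ∧ ∀ i < q.len, p.fn i = q.fn i
  le_refl p := ⟨le_rfl, fun _ => le_rfl, fun _ _ => rfl⟩
  le_trans p q r hpq hqr := ⟨hqr.1.trans hpq.1, fun i => (hqr.2.1 i).trans (hpq.2.1 i),
    fun i hi => (hpq.2.2 i (hi.trans_le hqr.1)).trans (hqr.2.2 i hi)⟩
  le_antisymm := by
    rintro ⟨n, g⟩ ⟨m, h⟩ hpq hqp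
    obtain rfl : n = m := le_antisymm hqp.1 hpq.1
    obtain rfl : g = h := funext fun i => le_antisymm (hqp.2.1 i) (hpq.2.1 i)
    rfl

instance : Nonempty HechlerCondition := ⟨⟨0, fun _ => 0⟩⟩

theorem le_def {p q : HechlerCondition} :
    p ≤ q ↔ q.len ≤ p.len ∧ (∀ i, q.fn i ≤ p.fn i) ∧ ∀ i < q.len, p.fn i = q.fn i := Iff.rfl

theorem isCCC : IsCCC HechlerCondition := by
  intro A hA
  -- Conditions with the same fixed part are compatible.
  refine Set.MapsTo.countable_of_injOn (t := (Set.univ : Set (List ℕ)))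
    (f := fun p => List.ofFn fun i : Fin p.len => p.fn i) (fun _ _ => trivial) ?_
    (Set.to_countable _)
  intro p hp q hq hpq
  by_contra hne
  refine hA hp hq hne ⟨⟨p.len, fun i => max (p.fn i) (q.fn i)⟩, ?_⟩
  have hlen : p.len = q.len := by simpa using congrArg List.length hpq
  have hfn : ∀ i < p.len, p.fn i = q.fn i := by
    intro i hi
    have := congrArg (fun l => l.getD i 0) hpq
    simpa [List.getD, hi, hlen ▸ hi] using this
  refine ⟨le_def.2 ⟨le_rfl, fun i => le_max_left _ _, fun i hi => ?_⟩,
    le_def.2 ⟨hlen.ge, fun i => le_max_right _ _, fun i hi => ?_⟩⟩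
  · simp [hfn i hi]
  · simp [hfn i (hlen ▸ hi)]

end HechlerCondition

theorem continuum_le_unboundingNumber (hMA : MartinsAxiom) : 𝔠 ≤ unboundingNumber := by
  have hne : {κ | ∃ B : Set (ℕ → ℕ), (¬ ∃ g, ∀ f ∈ B, EventuallyDominated f g) ∧ #B = κ}.Nonempty :=
    ⟨_, Set.univ, not_dominating_of_bounded dominating_univ, rfl⟩
  refine le_csInf hne ?_
  rintro _ ⟨B, hB, rfl⟩
  by_contra! hlt
  refine hB ?_
  let D : B ⊕ ℕ → Set HechlerCondition := Sum.elim
    (fun f => {p | ∀ i, p.len ≤ i → (f : ℕ → ℕ) i ≤ p.fn i}) (fun n => {p | n ≤ p.len})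
  have hcard : #(Set.range D) < 𝔠 := by
    refine mk_range_le.trans_lt ?_
    rw [mk_sum]
    simpa using add_lt_of_lt aleph0_le_continuum hlt aleph0_lt_continuum
  obtain ⟨G, hG⟩ := hMA HechlerCondition HechlerCondition.isCCC (Set.range D) hcard (by
    rintro _ ⟨f | n, rfl⟩ p
    · refine ⟨⟨p.len, fun i => if i < p.len then p.fn i else max (p.fn i) ((f : ℕ → ℕ) i)⟩,
        fun i hi => ?_, HechlerCondition.le_def.2 ⟨le_rfl, fun i => ?_, fun i hi => ?_⟩⟩
      · have hi : ¬ i < p.len := not_lt.2 hi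
        simp [hi]
      · dsimp only
        split_ifs <;> simp
      · simp [hi]
    · exact ⟨⟨max n p.len, p.fn⟩, le_max_left n p.len,
        HechlerCondition.le_def.2 ⟨le_max_right _ _, fun _ => le_rfl, fun _ _ => rfl⟩⟩)
  have hlen : ∀ n, ∃ p ∈ G, n ≤ p.len := by
    intro n
    obtain ⟨p, hp, hpG⟩ := hG _ ⟨Sum.inr n, rfl⟩
    exact ⟨p, hpG, hp⟩
  choose p hpG hp using hlen
  refine ⟨fun i => (p (i + 1)).fn i, fun f hf => ?_⟩
  obtain ⟨q, hq, hqG⟩ := hG _ ⟨Sum.inl ⟨f, hf⟩, rfl⟩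
  refine Filter.eventually_atTop.2 ⟨q.len, fun i hi => ?_⟩
  obtain ⟨r, -, hrp, hrq⟩ := G.directed (p (i + 1)) (hpG _) q hqG
  calc f i ≤ q.fn i := hq i hi
    _ ≤ r.fn i := hrq.2.1 i
    _ = (p (i + 1)).fn i := hrp.2.2 i (hp (i + 1))

/-- Cohen forcing: finite sequences of natural numbers, ordered by end-extension. -/
structure CohenCondition where
  /-- The finite sequence. -/
  seq : List ℕ

namespace CohenCondition

instance : PartialOrder CohenCondition where
  le p q := q.seq <+: p.seq
  le_refl p := List.prefix_rfl
  le_trans p q r hpq hqr := hqr.trans hpq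
  le_antisymm := by
    rintro ⟨s⟩ ⟨t⟩ h h'
    exact congrArg _ (h'.eq_of_length_le h.length_le)

instance : Nonempty CohenCondition := ⟨⟨[]⟩⟩

instance : Countable CohenCondition :=
  Function.Injective.countable (f := seq) (by rintro ⟨s⟩ ⟨t⟩ rfl; rfl)

theorem le_def {p q : CohenCondition} : p ≤ q ↔ q.seq <+: p.seq := Iff.rfl

/-- The points of `ω^ω` that extend a condition. -/
def cyl (p : CohenCondition) : Set (ℕ → ℕ) := {z | ∀ i < p.seq.length, z i = p.seq.getD i 0}

theorem getD_eq_of_le {p q : CohenCondition} (h : p ≤ q) {i : ℕ} (hi : i < q.seq.length) :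
    p.seq.getD i 0 = q.seq.getD i 0 := by
  obtain ⟨t, ht⟩ := le_def.1 h
  rw [← ht, List.getD_append _ _ _ _ hi]

/-- The condition given by the first `m` values of `z`. -/
def restrict (z : ℕ → ℕ) (m : ℕ) : CohenCondition := ⟨(List.range m).map z⟩

theorem length_restrict (z : ℕ → ℕ) (m : ℕ) : (restrict z m).seq.length = m := by
  simp [restrict]

theorem getD_restrict (z : ℕ → ℕ) {m i : ℕ} (hi : i < m) : (restrict z m).seq.getD i 0 = z i := by
  simp [restrict, List.getD, hi]

theorem cyl_restrict (z : ℕ → ℕ) (m : ℕ) : (restrict z m).cyl = PiNat.cylinder z m := by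
  ext w
  simp only [cyl, length_restrict, PiNat.mem_cylinder_iff]
  exact forall₂_congr fun i hi => by rw [getD_restrict z hi]

theorem restrict_le {p : CohenCondition} {z : ℕ → ℕ} (hz : z ∈ p.cyl) {m : ℕ}
    (hm : p.seq.length ≤ m) : restrict z m ≤ p := by
  rw [le_def, List.prefix_iff_getElem]
  refine ⟨by rwa [length_restrict], fun i hi => ?_⟩
  have := hz i hi
  simp [restrict, this, List.getD, hi]

theorem isOpen_cyl (p : CohenCondition) : IsOpen p.cyl := by
  have : p.cyl = PiNat.cylinder (fun i => p.seq.getD i 0) p.seq.length := rfl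
  rw [this]
  exact PiNat.isOpen_cylinder (fun _ : ℕ => ℕ) _ _

theorem nonempty_cyl (p : CohenCondition) : p.cyl.Nonempty :=
  ⟨fun i => p.seq.getD i 0, fun _ _ => rfl⟩

end CohenCondition

theorem continuum_le_covMeager (hMA : MartinsAxiom) : 𝔠 ≤ covMeager := by
  have hne : {κ | ∃ S : Set (Set (ℕ → ℕ)), (∀ s ∈ S, IsNowhereDense s) ∧ ⋃₀ S = Set.univ ∧
      #S = κ}.Nonempty := by
    refine ⟨_, Set.range fun z : ℕ → ℕ => ({z} : Set (ℕ → ℕ)), ?_, ?_, rfl⟩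
    · rintro _ ⟨z, rfl⟩
      exact isNowhereDense_singleton_baire z
    · exact Set.eq_univ_of_forall fun z => ⟨{z}, ⟨z, rfl⟩, rfl⟩
  refine le_csInf hne ?_
  rintro _ ⟨S, hS, hScov, rfl⟩
  by_contra! hlt
  let D : S ⊕ ℕ → Set CohenCondition := Sum.elim
    (fun s => {p | Disjoint p.cyl s}) (fun n => {p | n ≤ p.seq.length})
  have hcard : #(Set.range D) < 𝔠 := by
    refine mk_range_le.trans_lt ?_
    rw [mk_sum]
    simpa using add_lt_of_lt aleph0_le_continuum hlt aleph0_lt_continuum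
  obtain ⟨G, hG⟩ := hMA CohenCondition (fun A _ => Set.to_countable A) (Set.range D) hcard (by
    rintro _ ⟨s | n, rfl⟩ p
    · have hnd : interior (closure (s : Set (ℕ → ℕ))) = ∅ := hS s s.2
      obtain ⟨z, hz, hzs⟩ : ∃ z ∈ p.cyl, z ∉ closure (s : Set (ℕ → ℕ)) := by
        by_contra! h
        obtain ⟨z, hz⟩ := p.nonempty_cyl
        have := interior_maximal h p.isOpen_cyl hz
        rwa [hnd] at this
      obtain ⟨m, hm⟩ := exists_cylinder_subset isClosed_closure.isOpen_compl hzs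
      refine ⟨CohenCondition.restrict z (max m p.seq.length), ?_,
        CohenCondition.restrict_le hz (le_max_right _ _)⟩
      change Disjoint (CohenCondition.cyl _) _
      rw [CohenCondition.cyl_restrict]
      exact Set.disjoint_left.2 fun w hw hws =>
        hm (PiNat.cylinder_anti z (le_max_left _ _) hw) (subset_closure hws)
    · obtain ⟨z, hz⟩ := p.nonempty_cyl
      refine ⟨CohenCondition.restrict z (max n p.seq.length), ?_,
        CohenCondition.restrict_le hz (le_max_right _ _)⟩
      change n ≤ _
      rw [CohenCondition.length_restrict]
      exact le_max_left _ _)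
  have hlen : ∀ n, ∃ p ∈ G, n ≤ p.seq.length := by
    intro n
    obtain ⟨p, hp, hpG⟩ := hG _ ⟨Sum.inr n, rfl⟩
    exact ⟨p, hpG, hp⟩
  choose p hpG hp using hlen
  let z : ℕ → ℕ := fun i => (p (i + 1)).seq.getD i 0
  have hz : ∀ q ∈ G, z ∈ CohenCondition.cyl q := by
    intro q hq i hi
    obtain ⟨r, -, hrp, hrq⟩ := G.directed (p (i + 1)) (hpG _) q hq
    rw [← CohenCondition.getD_eq_of_le hrq hi]
    exact (CohenCondition.getD_eq_of_le hrp (hp (i + 1))).symm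
  obtain ⟨s, hs, hzs⟩ : z ∈ ⋃₀ S := hScov ▸ Set.mem_univ z
  obtain ⟨q, hq, hqG⟩ := hG _ ⟨Sum.inl ⟨s, hs⟩, rfl⟩
  exact Set.disjoint_left.1 hq (hz q hqG) hzs

/-! ### The characterization -/

theorem exists_uncountable_FLS_iff (hb : ℵ₁ < unboundingNumber)
    (hbd : unboundingNumber = dominatingNumber) (hdc : dominatingNumber = covMeager)
    (l : Ordinal.{u}) :
    (∃ (X : Type u) (_ : TopologicalSpace X), IsFLS X ∧ Uncountable X ∧ scatteredHeight X = l) ↔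
      (Ordinal.omega0 ≤ l ∧ l < (Order.succ (𝔠 : Cardinal.{u})).ord ∧ l.cof ≤ ℵ₀ ∧
        ((limitPart l).cof = ℵ₀ ∨
          (limitPart l).cof = Cardinal.lift.{u} dominatingNumber.ord.cof)) := by
  have hd1 : ℵ₁ < dominatingNumber := hbd ▸ hb
  have hd : ℵ₀ < dominatingNumber := aleph0_lt_aleph_one.trans hd1
  rw [cof_ord_dominatingNumber hbd]
  obtain ⟨hpre, n, hn⟩ := limitPart_spec l
  constructor
  · rintro ⟨X, _, ⟨_, _, _, hX⟩, hunc, rfl⟩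
    set μ := limitPart (scatteredHeight X)
    have hμl : μ ≤ scatteredHeight X := le_self_add.trans_eq hn.symm
    have hμc : (cbDerivative X μ).Countable := countable_cbDerivative_of_add_nat hb n (by
      rw [← hn, cbDerivative_scatteredHeight hX]
      exact Set.countable_empty)
    have hμ0 : μ ≠ 0 := by
      intro h
      rw [h, cbDerivative, CantorBendixson.iteratedDerivedSet_zero] at hμc
      exact Set.not_countable_univ hμc
    have hlim : Order.IsSuccLimit μ := ⟨by simpa using hμ0, hpre⟩
    refine ⟨(Ordinal.omega0_le_of_isSuccLimit hlim).trans hμl, ?_, cof_scatteredHeight_le hX, ?_⟩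
    · rw [lt_ord, Order.lt_succ_iff]
      exact (card_scatteredHeight_le hX).trans (mk_le_continuum_of_lindelof X)
    · rcases (Ordinal.aleph0_le_cof_iff.2 (Ordinal.one_lt_cof_iff.2 hlim)).eq_or_lt with h | h
      · exact Or.inl h.symm
      · exact Or.inr (cof_eq_dominatingNumber hX hbd hd h hμl hμc)
  · rintro ⟨-, hlc, hcof, hμ⟩
    have hμc : (limitPart l).card ≤ 𝔠 := by
      rw [lt_ord, Order.lt_succ_iff] at hlc
      exact (Ordinal.card_le_card (le_self_add.trans_eq hn.symm)).trans hlc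
    rcases hμ with hμ | hμ
    · have := exists_uncountable_FLS_of_cof_eq_aleph0 hμc hμ n (hdc ▸ hd)
      rwa [← hn] at this
    · have hn0 : n ≠ 0 := by
        rintro rfl
        rw [Nat.cast_zero, add_zero] at hn
        rw [← hn] at hμ
        rw [hμ] at hcof
        exact hd.not_ge (by simpa using hcof)
      have := exists_uncountable_FLS_of_cof_eq_dominatingNumber hμc hdc hd hμ hn0
      rwa [← hn] at this

theorem corollary6 :
    (ℵ₁ < unboundingNumber → unboundingNumber = dominatingNumber →
      dominatingNumber = covMeager →
      ∀ l : Ordinal.{u},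
        (∃ (X : Type u) (_ : TopologicalSpace X),
            IsFLS X ∧ Uncountable X ∧ scatteredHeight X = l) ↔
          (Ordinal.omega0 ≤ l ∧ l < (Order.succ (𝔠 : Cardinal.{u})).ord ∧ l.cof ≤ ℵ₀ ∧
            ((limitPart l).cof = ℵ₀ ∨
              (limitPart l).cof = Cardinal.lift.{u} dominatingNumber.ord.cof))) ∧
    (MartinsAxiom → ℵ₁ < (𝔠 : Cardinal.{0}) →
      ∀ l : Ordinal.{u},
        (∃ (X : Type u) (_ : TopologicalSpace X),
            IsFLS X ∧ Uncountable X ∧ scatteredHeight X = l) ↔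
          (Ordinal.omega0 ≤ l ∧ l < (Order.succ (𝔠 : Cardinal.{u})).ord ∧ l.cof ≤ ℵ₀ ∧
            ((limitPart l).cof = ℵ₀ ∨
              (limitPart l).cof = Cardinal.lift.{u} dominatingNumber.ord.cof))) := by
  refine ⟨exists_uncountable_FLS_iff, fun hMA hc l => ?_⟩
  have hb := continuum_le_unboundingNumber hMA
  have hbd := unboundingNumber_le_dominatingNumber
  have hd := dominatingNumber_le_continuum
  exact exists_uncountable_FLS_iff (hc.trans_le hb) (le_antisymm hbd (hd.trans hb))
    (le_antisymm (hd.trans (continuum_le_covMeager hMA))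
      (covMeager_le_continuum.trans (hb.trans hbd))) l
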